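/- Let $Q \ll P$ be probability measures on a measurable space $\Omega$ such that $D_{\mathrm{KL}}(Q\|P) = \mathbb{E}_{X\sim Q}\big[\log_2 \tfrac{dQ}{dP}(X)\big]$ is finite, and let $\widetilde r : \Omega \to [0,\infty]$ be a measurable unnormalised density ratio, i.e. $\widetilde r = c\,\frac{dQ}{dP}$ $P$-almost everywhere for some constant $c\in(0,\infty)$ (no bound on $\widetilde r$ is assumed). Let $X_1, X_2, \dots$ be i.i.d. with law $P$, and, independently of them, let $G_1, G_2, \dots$ be such that $G_1$ is standard Gumbel (location $0$, scale $1$) and, given $G_1,\dots,G_{i-1}$, the variable $G_i$ is standard Gumbel truncated to $(-\infty, G_{i-1})$. Depth-limited A* coding with budget $k$ starts with $N = 0$, $Y = \perp$, $L = -\infty$, and for $i = 1, \dots, k$ does the following: if $L < \ln \widetilde r(X_i) + G_i$ (with $\ln 0 = -\infty$), it sets $L \leftarrow \ln\widetilde r(X_i) + G_i$ and $(N, Y) \leftarrow (i, X_i)$. It returns $(N, Y)$. Then for every $\varepsilon > 0$ and every integer $k$ with $$k \;\ge\; \left\lfloor 2^{\left(D_{\mathrm{KL}}(Q\|P) + e^{-1}\log_2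 e + 1\right)/\varepsilon} \right\rfloor ,$$ the returned index satisfies $N \le k$, and the law $\widetilde Q$ of the output $Y$ (a probability measure on $\Omega\cup\{\perp\}$) satisfies $$D_{TV}(\widetilde Q, Q) = \sup_{B} |\widetilde Q(B) - Q(B)| \le \varepsilon ,$$ where $Q$ is regarded as a measure on $\Omega\cup\{\perp\}$ with $Q(\{\perp\}) = 0$ and $B$ ranges over the measurable subsets of $\Omega\cup\{\perp\}$. -/

import Mathlib

open MeasureTheory ProbabilityTheory Filter Topology
open scoped ENNReal

noncomputable section

namespace AStarCoding

/-! ### Total variation and Kullback-Leibler divergence -/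

/-- Total variation distance `sup_B |μ(B) - ν(B)|` over the measurable sets `B`
(used for probability measures, where the supremum is over a bounded family). -/
def tvDist {α : Type*} [MeasurableSpace α] (μ ν : Measure α) : ℝ :=
  ⨆ B : {B : Set α // MeasurableSet B}, |μ.real B.1 - ν.real B.1|

/-- The integrand `log₂ (dQ/dP)` of the Kullback-Leibler divergence. -/
def logRatio {Ω : Type*} [MeasurableSpace Ω] (Q P : Measure Ω) (x : Ω) : ℝ :=
  Real.logb 2 (Q.rnDeriv P x).toReal

/-- Kullback-Leibler divergence in bits, `E_{X ∼ Q} [log₂ (dQ/dP)(X)]`; to be used for `Q ≪ P` with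
`logRatio Q P` integrable under `Q`, i.e. when the divergence is finite. -/
def klBits {Ω : Type*} [MeasurableSpace Ω] (Q P : Measure Ω) : ℝ :=
  ∫ x, logRatio Q P x ∂Q

/-! ### Gumbel noise -/

/-- Density of the standard Gumbel distribution (location `0`, scale `1`). -/
def gumbelPDF (x : ℝ) : ℝ := Real.exp (-(x + Real.exp (-x)))

/-- The standard Gumbel distribution (location `0`, scale `1`). -/
def gumbel : Measure ℝ := volume.withDensity fun x => ENNReal.ofReal (gumbelPDF x)

lemma gumbelPDF_pos (x : ℝ) : 0 < gumbelPDF x := Real.exp_pos _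

lemma measurable_gumbelPDF : Measurable gumbelPDF := by
  unfold gumbelPDF; fun_prop

instance : IsProbabilityMeasure gumbel := by
  have hd : ∀ x : ℝ, HasDerivAt (fun x => Real.exp (-Real.exp (-x))) (gumbelPDF x) x := by
    intro x
    have h1 : HasDerivAt (fun x : ℝ => Real.exp (-x)) (Real.exp (-x) * (-1)) x :=
      (hasDerivAt_neg x).exp
    have h2 : HasDerivAt (fun x : ℝ => Real.exp (-Real.exp (-x)))
        (Real.exp (-Real.exp (-x)) * -(Real.exp (-x) * (-1))) x := h1.neg.exp
    convert h2 using 1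
    rw [gumbelPDF]
    rw [neg_add, Real.exp_add]
    ring
  have hbot : Tendsto (fun x : ℝ => Real.exp (-Real.exp (-x))) atBot (𝓝 0) :=
    Real.tendsto_exp_neg_atTop_nhds_zero.comp
      (Real.tendsto_exp_atTop.comp tendsto_neg_atBot_atTop)
  have htop : Tendsto (fun x : ℝ => Real.exp (-Real.exp (-x))) atTop (𝓝 1) := by
    have h : Tendsto (fun x : ℝ => -Real.exp (-x)) atTop (𝓝 (-0)) :=
      Real.tendsto_exp_neg_atTop_nhds_zero.neg
    have h2 := (Real.continuous_exp.tendsto (-0)).comp h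
    simpa [Function.comp_def] using h2
  have hc : Continuous gumbelPDF := by unfold gumbelPDF; fun_prop
  have hint : Integrable gumbelPDF := by
    refine integrable_of_intervalIntegral_norm_bounded (l := atTop) (a := fun i : ℝ => -i)
      (b := fun i : ℝ => i) 1
      (fun i => hc.locallyIntegrable.integrableOn_isCompact isCompact_Icc |>.mono_set
        Set.Ioc_subset_Icc_self) tendsto_neg_atTop_atBot tendsto_id (Eventually.of_forall fun i => ?_)
    have hn : ∀ x, ‖gumbelPDF x‖ = gumbelPDF x := fun x =>
      Real.norm_of_nonneg (gumbelPDF_pos x).le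
    simp only [hn]
    rw [intervalIntegral.integral_eq_sub_of_hasDerivAt (fun x _ => hd x)
      (hc.intervalIntegrable _ _)]
    have h1 : Real.exp (-Real.exp (-i)) ≤ 1 := by
      rw [Real.exp_le_one_iff]; linarith [Real.exp_pos (-i)]
    linarith [Real.exp_pos (-Real.exp (- -i))]
  have hI : ∫ x, gumbelPDF x = 1 := by
    rw [integral_of_hasDerivAt_of_tendsto hd hint hbot htop]; simp
  constructor
  rw [gumbel, withDensity_apply _ MeasurableSet.univ, Measure.restrict_univ,
    ← ofReal_integral_eq_lintegral_ofReal hint (ae_of_all _ fun x => (gumbelPDF_pos x).le), hI]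
  simp

lemma gumbel_Iio_ne_zero (b : ℝ) : gumbel (Set.Iio b) ≠ 0 := by
  intro h
  rw [gumbel, withDensity_apply _ measurableSet_Iio,
    setLIntegral_eq_zero_iff measurableSet_Iio
      measurable_gumbelPDF.ennreal_ofReal] at h
  have h2 : volume (Set.Iio b) = 0 := by
    refine measure_mono_null (fun x hx => ?_) h
    simp only [Set.mem_compl_iff, Set.mem_ofPred_eq, Classical.not_imp]
    exact ⟨hx, by simpa using gumbelPDF_pos x⟩
  simp at h2

/-- The standard Gumbel distribution truncated to `(-∞, b)`, as a Markov kernel in `b`. -/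
def truncGumbel : Kernel ℝ ℝ where
  toFun b := gumbel[|Set.Iio b]
  measurable' := by
    refine Measure.measurable_of_measurable_coe _ fun s hs => ?_
    have hm : ∀ t : Set ℝ, Measurable fun b : ℝ => gumbel (Set.Iio b ∩ t) := fun t =>
      (Monotone.measurable fun a b hab =>
        measure_mono (Set.inter_subset_inter_left _ (Set.Iio_subset_Iio hab)))
    simp only [cond_apply measurableSet_Iio]
    have h1 := hm Set.univ
    simp only [Set.inter_univ] at h1
    exact h1.inv.mul (hm s)

instance : IsMarkovKernel truncGumbel :=
  ⟨fun b => cond_isProbabilityMeasure (gumbel_Iio_ne_zero b)⟩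

/-- The law of the infinite noise sequence `(G₁, G₂, …)` (stored from index `0` on): `G₁` is standard
Gumbel, and given `G₁, …, Gᵢ` the next value is standard Gumbel truncated to `(-∞, Gᵢ)`. -/
def gumbelChain : Measure (ℕ → ℝ) :=
  Kernel.trajMeasure (X := fun _ => ℝ) gumbel fun n =>
    truncGumbel.comap (fun g : (Finset.Iic n → ℝ) => g ⟨n, Finset.mem_Iic.2 le_rfl⟩)
      (measurable_pi_apply _)

/-! ### Depth-limited A* coding -/

/-- The variables `N, Y, L` of the algorithm. `Sum.inr ()` stands for the initial value `⊥` of `Y`. -/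
structure State (Ω : Type*) where
  N : ℕ
  Y : Ω ⊕ Unit
  L : EReal

/-- Body of the loop in round `i`, with proposal `x` and noise value `g`
(`ENNReal.log 0 = -∞`). -/
def State.step {Ω : Type*} (r : Ω → ℝ≥0∞) (i : ℕ) (x : Ω) (g : ℝ) (s : State Ω) : State Ω :=
  if s.L < ENNReal.log (r x) + (g : EReal) then
    { N := i, Y := Sum.inl x, L := ENNReal.log (r x) + (g : EReal) }
  else s

/-- Depth-limited A* coding with budget `k`, run with the unnormalised density ratio `r` on the
proposals `x 0, x 1, …` and the noise values `g 0, g 1, …` (round `i` uses `x (i-1)`, `g (i-1)`).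
The output is the pair `N, Y` of the final state. -/
def depthLimitedAStar {Ω : Type*} (r : Ω → ℝ≥0∞) (x : ℕ → Ω) (g : ℕ → ℝ) : ℕ → State Ω
  | 0 => { N := 0, Y := Sum.inr (), L := ⊥ }
  | k + 1 => (depthLimitedAStar r x g k).step r (k + 1) (x k) (g k)

end AStarCoding

end

namespace AStarCoding

/-! ### Integrals over triangles -/

/-! Put T_i = exp(-G_i) and ρ = dQ/dP. The Gumbel chain becomes the arrival times T_1 < T_2 < ... of
a rate-one Poisson process, and the algorithm keeps a maximiser of ρ(X_i)/T_i among the first k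
proposals; the constant c cancels in every comparison. Since ties can only lose mass, the output has
density with respect to P at least equal, at a point with ratio Y, to the mean number of j ≤ k for
which a proposal of ratio Y at time T_j strictly beats the k - 1 others.

Given T_{k+1} = t, the first k arrivals are k uniform points of (0, t) in increasing order. Hence
that mean is the integral of e^{-t} H_τ(t)^{k-1}/(k-1)! over 0 < τ < t, where H_τ(t) is the integral
of P(ρ < vY/τ) over 0 < v < t (`lintegral_gumbelChain_sum_prod`). Because ρ has P-mean at most 1,
H_τ(t) ≥ t - τ/Y, and integrating over τ < min(1, Y) t gives the lower bound Y (1 - δ^k) with δ = 1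
- min(1, Y)/Y (`le_lintegral_gumbelChain_sum_prod`). So Q(B) exceeds the output mass of B by at most
E_Q[δ^k] (`measure_le_measure_depthLimitedAStar_add`), and complements turn this into a total
variation bound.

Finally δ^k ln(k+1) ≤ ln(1+Y) ≤ ln Y + ln 2 + (1/Y - 1)/2 (`defect_pow_mul_log_le`). As E_Q[1/Y] ≤
1, the last term has nonpositive mean, so E_Q[δ^k] log₂(k+1) ≤ D_KL + 1, and the condition on k
makes this at most ε log₂(k+1). -/

lemma measurable_lintegral_Ioo {α : Type*} [MeasurableSpace α] {f : α → ℝ → ℝ≥0∞}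
    (hf : Measurable (Function.uncurry f)) {a b : α → ℝ} (ha : Measurable a) (hb : Measurable b) :
    Measurable fun x => ∫⁻ v in Set.Ioo (a x) (b x), f x v := by
  have hs : MeasurableSet {p : α × ℝ | p.2 ∈ Set.Ioo (a p.1) (b p.1)} :=
    (measurableSet_lt (ha.comp measurable_fst) measurable_snd).inter
      (measurableSet_lt measurable_snd (hb.comp measurable_fst))
  have h := (hf.indicator hs).lintegral_prod_right' (ν := volume)
  convert h using 2 with x
  rw [← lintegral_indicator measurableSet_Ioo]
  rfl

lemma measurable_lintegral_Ioi {α : Type*} [MeasurableSpace α] {f : α → ℝ → ℝ≥0∞}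
    (hf : Measurable (Function.uncurry f)) {a : α → ℝ} (ha : Measurable a) :
    Measurable fun x => ∫⁻ v in Set.Ioi (a x), f x v := by
  have hs : MeasurableSet {p : α × ℝ | p.2 ∈ Set.Ioi (a p.1)} :=
    measurableSet_lt (ha.comp measurable_fst) measurable_snd
  have h := (hf.indicator hs).lintegral_prod_right' (ν := volume)
  convert h using 2 with x
  rw [← lintegral_indicator measurableSet_Ioi]
  rfl

lemma lintegral_Ioi_Ioo_swap (a : ℝ) {f : ℝ → ℝ → ℝ≥0∞} (hf : Measurable (Function.uncurry f)) :
    ∫⁻ u in Set.Ioi a, ∫⁻ t in Set.Ioo a u, f t u = ∫⁻ t in Set.Ioi a, ∫⁻ u in Set.Ioi t, f t u := by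
  have hs : MeasurableSet {p : ℝ × ℝ | a < p.1 ∧ p.1 < p.2} :=
    (measurableSet_lt measurable_const measurable_fst).inter
      (measurableSet_lt measurable_fst measurable_snd)
  have h1 : ∫⁻ u in Set.Ioi a, ∫⁻ t in Set.Ioo a u, f t u
      = ∫⁻ u, ∫⁻ t, {p : ℝ × ℝ | a < p.1 ∧ p.1 < p.2}.indicator (Function.uncurry f) (t, u) := by
    rw [← lintegral_indicator measurableSet_Ioi]
    congr 1 with u
    by_cases hu : a < u
    · rw [Set.indicator_of_mem (show u ∈ Set.Ioi a from hu), ← lintegral_indicator measurableSet_Ioo]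
      rfl
    · rw [Set.indicator_of_notMem (show u ∉ Set.Ioi a from hu)]
      symm
      rw [lintegral_eq_zero_of_ae_eq_zero]
      refine ae_of_all _ fun t => Set.indicator_of_notMem (fun h => hu ?_) _
      exact h.1.trans h.2
  have h2 : ∫⁻ t in Set.Ioi a, ∫⁻ u in Set.Ioi t, f t u
      = ∫⁻ t, ∫⁻ u, {p : ℝ × ℝ | a < p.1 ∧ p.1 < p.2}.indicator (Function.uncurry f) (t, u) := by
    rw [← lintegral_indicator measurableSet_Ioi]
    congr 1 with t
    by_cases ht : a < t
    · rw [Set.indicator_of_mem (show t ∈ Set.Ioi a from ht), ← lintegral_indicator measurableSet_Ioi]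
      congr 1 with u
      by_cases hu : t < u
      · rw [Set.indicator_of_mem (show u ∈ Set.Ioi t from hu),
          Set.indicator_of_mem (show (t, u) ∈ {p : ℝ × ℝ | a < p.1 ∧ p.1 < p.2} from ⟨ht, hu⟩)]
        rfl
      · rw [Set.indicator_of_notMem (show u ∉ Set.Ioi t from hu),
          Set.indicator_of_notMem (fun h => hu h.2)]
    · rw [Set.indicator_of_notMem (show t ∉ Set.Ioi a from ht)]
      symm
      rw [lintegral_eq_zero_of_ae_eq_zero]
      exact ae_of_all _ fun t => Set.indicator_of_notMem (fun h => ht h.1) _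
  rw [h1, h2]
  exact (lintegral_lintegral_swap (f := fun t u =>
    {p : ℝ × ℝ | a < p.1 ∧ p.1 < p.2}.indicator (Function.uncurry f) (t, u))
    (hf.indicator hs).aemeasurable).symm

lemma lintegral_Ioo_Ioo_swap (a b : ℝ) {f : ℝ → ℝ → ℝ≥0∞}
    (hf : Measurable (Function.uncurry f)) :
    ∫⁻ u in Set.Ioo a b, ∫⁻ t in Set.Ioo a u, f t u
      = ∫⁻ t in Set.Ioo a b, ∫⁻ u in Set.Ioo t b, f t u := by
  have hm : Measurable (Function.uncurry fun t u => (Set.Iio b).indicator (f t) u) := by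
    have : MeasurableSet {p : ℝ × ℝ | p.2 < b} := measurableSet_lt measurable_snd measurable_const
    exact hf.indicator this
  have h := lintegral_Ioi_Ioo_swap a hm
  have h1 : ∀ t, ∫⁻ u in Set.Ioi t, (Set.Iio b).indicator (f t) u = ∫⁻ u in Set.Ioo t b, f t u := by
    intro t
    rw [setLIntegral_indicator measurableSet_Iio, Set.inter_comm, Set.Ioi_inter_Iio]
  simp only [h1] at h
  have h2 : ∀ F : ℝ → ℝ≥0∞, (∀ t, b ≤ t → F t = 0) →
      ∫⁻ t in Set.Ioi a, F t = ∫⁻ t in Set.Ioo a b, F t := by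
    intro F hF
    rw [← Set.Ioi_inter_Iio, Set.inter_comm, ← setLIntegral_indicator measurableSet_Iio]
    congr 1 with t
    by_cases ht : t < b
    · rw [Set.indicator_of_mem (show t ∈ Set.Iio b from ht)]
    · rw [Set.indicator_of_notMem (show t ∉ Set.Iio b from ht), hF t (not_lt.1 ht)]
  rw [h2, h2] at h
  · rw [← h]
    refine setLIntegral_congr_fun measurableSet_Ioo fun u hu => ?_
    simp only [Set.indicator_of_mem (show u ∈ Set.Iio b from hu.2)]
  · intro t ht
    rw [Set.Ioo_eq_empty (not_lt.2 ht)]; simp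
  · intro t ht
    simp [Set.indicator_of_notMem (show t ∉ Set.Iio b from not_lt.2 ht)]

lemma lintegral_Ioo_add_lintegral_Ioo (q : ℝ → ℝ≥0∞) {a b c : ℝ} (hab : a ≤ b) (hbc : b < c) :
    (∫⁻ v in Set.Ioo a b, q v) + ∫⁻ v in Set.Ioo b c, q v = ∫⁻ v in Set.Ioo a c, q v := by
  rw [Measure.restrict_congr_set (Ioo_ae_eq_Ioc (a := a) (b := b)),
    ← Set.Ioc_union_Ioo_eq_Ioo hab hbc, lintegral_union measurableSet_Ioo]
  rw [Set.disjoint_left]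
  intro x h1 h2
  exact absurd h1.2 (not_le.2 h2.1)

/-- The integral of a power of a primitive against its density. -/
lemma lintegral_mul_primitive_pow {q : ℝ → ℝ≥0∞} (hq : Measurable q) (n : ℕ) (t : ℝ) :
    (n + 1) * (∫⁻ u in Set.Ioo 0 t, q u * (∫⁻ v in Set.Ioo 0 u, q v) ^ n)
      = (∫⁻ v in Set.Ioo 0 t, q v) ^ (n + 1) := by
  have hH : Measurable fun u : ℝ => ∫⁻ v in Set.Ioo 0 u, q v :=
    measurable_lintegral_Ioo (f := fun _ v => q v) (by fun_prop) measurable_const measurable_id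
  induction n generalizing t with
  | zero => simp
  | succ n ih =>
    have hm : Measurable fun w => q w * (∫⁻ v in Set.Ioo 0 w, q v) ^ n := by fun_prop
    -- As `q` is merely measurable, Tonelli on a triangle replaces differentiation: the induction
    -- hypothesis writes the inner power as an integral over w < u.
    have hI : ∫⁻ u in Set.Ioo 0 t, q u * (∫⁻ v in Set.Ioo 0 u, q v) ^ (n + 1)
        = (n + 1) * ∫⁻ w in Set.Ioo 0 t, q w * (∫⁻ v in Set.Ioo 0 w, q v) ^ n *
            ∫⁻ u in Set.Ioo w t, q u := by
      simp_rw [← ih]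
      have := lintegral_Ioo_Ioo_swap 0 t
        (f := fun w u => q w * (∫⁻ v in Set.Ioo 0 w, q v) ^ n * q u)
        ((hm.comp measurable_fst).mul (hq.comp measurable_snd))
      simp_rw [lintegral_const_mul _ hq, lintegral_mul_const _ hm] at this
      rw [← this, ← lintegral_const_mul]
      · congr 1 with u
        ring
      · refine Measurable.mul ?_ hq
        exact measurable_lintegral_Ioo (f := fun _ w => q w * (∫⁻ v in Set.Ioo 0 w, q v) ^ n)
          (hm.comp measurable_snd)
          measurable_const measurable_id
    have hadd : (∫⁻ w in Set.Ioo 0 t, q w * (∫⁻ v in Set.Ioo 0 w, q v) ^ n *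
            ∫⁻ u in Set.Ioo w t, q u)
          + ∫⁻ w in Set.Ioo 0 t, q w * (∫⁻ v in Set.Ioo 0 w, q v) ^ (n + 1)
        = (∫⁻ w in Set.Ioo 0 t, q w * (∫⁻ v in Set.Ioo 0 w, q v) ^ n) *
            ∫⁻ v in Set.Ioo 0 t, q v := by
      rw [← lintegral_add_right _ (by fun_prop), ← lintegral_mul_const _ hm]
      refine setLIntegral_congr_fun measurableSet_Ioo fun w hw => ?_
      rw [← lintegral_Ioo_add_lintegral_Ioo q hw.1.le hw.2]
      ring
    push_cast
    calc ((n : ℝ≥0∞) + 1 + 1) * ∫⁻ u in Set.Ioo 0 t, q u * (∫⁻ v in Set.Ioo 0 u, q v) ^ (n + 1)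
        = (n + 1) * (∫⁻ u in Set.Ioo 0 t, q u * (∫⁻ v in Set.Ioo 0 u, q v) ^ (n + 1))
          + ∫⁻ u in Set.Ioo 0 t, q u * (∫⁻ v in Set.Ioo 0 u, q v) ^ (n + 1) := by ring
      _ = (n + 1) * ((∫⁻ w in Set.Ioo 0 t, q w * (∫⁻ v in Set.Ioo 0 w, q v) ^ n *
            ∫⁻ u in Set.Ioo w t, q u)
          + ∫⁻ u in Set.Ioo 0 t, q u * (∫⁻ v in Set.Ioo 0 u, q v) ^ (n + 1)) := by
          conv_lhs => arg 2; rw [hI]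
          ring
      _ = _ := by rw [hadd, ← mul_assoc, ih]; ring

lemma lintegral_mul_primitive_pow_div_factorial {q : ℝ → ℝ≥0∞} (hq : Measurable q) (n : ℕ) (t : ℝ) :
    ∫⁻ u in Set.Ioo 0 t, q u * ((∫⁻ v in Set.Ioo 0 u, q v) ^ n / n.factorial)
      = (∫⁻ v in Set.Ioo 0 t, q v) ^ (n + 1) / (n + 1).factorial := by
  have hH : Measurable fun u : ℝ => ∫⁻ v in Set.Ioo 0 u, q v :=
    measurable_lintegral_Ioo (f := fun _ v => q v) (by fun_prop) measurable_const measurable_id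
  have h0 : (((n + 1 : ℕ) : ℝ≥0∞)) ≠ 0 := by simp
  rw [← lintegral_mul_primitive_pow hq n t]
  simp_rw [div_eq_mul_inv, ← mul_assoc]
  rw [lintegral_mul_const _ (by fun_prop), Nat.factorial_succ, Nat.cast_mul,
    ENNReal.mul_inv (Or.inl h0) (Or.inl (by simp)), ← Nat.cast_succ, Nat.succ_eq_add_one,
    mul_comm ((n + 1 : ℕ) : ℝ≥0∞), mul_assoc, ← mul_assoc ((n + 1 : ℕ) : ℝ≥0∞),
    ENNReal.mul_inv_cancel h0 (by simp), one_mul]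

/-! ### The Gumbel chain in exponential coordinates -/

/-- Change of variables u = exp(-x): the Gumbel law becomes the standard exponential law. -/
lemma setLIntegral_gumbel_exp_neg {φ : ℝ → ℝ≥0∞} (hφ : Measurable φ) {s : Set ℝ}
    (hs : MeasurableSet s) :
    ∫⁻ x in s, φ (Real.exp (-x)) ∂gumbel
      = ∫⁻ u in (fun x => Real.exp (-x)) '' s, ENNReal.ofReal (Real.exp (-u)) * φ u := by
  have hd : ∀ x ∈ s, HasDerivWithinAt (fun x : ℝ => Real.exp (-x)) (Real.exp (-x) * (-1)) s x :=
    fun x _ => (hasDerivAt_neg x).exp.hasDerivWithinAt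
  have hinj : Set.InjOn (fun x : ℝ => Real.exp (-x)) s := fun x _ y _ h => by
    simpa using h
  rw [lintegral_image_eq_lintegral_abs_deriv_mul hs hd hinj, gumbel,
    setLIntegral_withDensity_eq_setLIntegral_mul _ measurable_gumbelPDF.ennreal_ofReal
      (by fun_prop) hs]
  refine setLIntegral_congr_fun hs fun x _ => ?_
  simp only [Pi.mul_apply]
  rw [← mul_assoc, ← ENNReal.ofReal_mul (abs_nonneg _), gumbelPDF, neg_add, Real.exp_add]
  simp

lemma lintegral_gumbel_exp_neg {φ : ℝ → ℝ≥0∞} (hφ : Measurable φ) :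
    ∫⁻ x, φ (Real.exp (-x)) ∂gumbel
      = ∫⁻ u in Set.Ioi 0, ENNReal.ofReal (Real.exp (-u)) * φ u := by
  have h := setLIntegral_gumbel_exp_neg hφ MeasurableSet.univ
  rw [Measure.restrict_univ, Set.image_univ] at h
  rw [h]
  congr 2
  have : (fun x : ℝ => Real.exp (-x)) = Real.exp ∘ Neg.neg := rfl
  rw [this, Set.range_comp, neg_surjective.range_eq, Set.image_univ, Real.range_exp]

lemma setLIntegral_Iio_gumbel_exp_neg {φ : ℝ → ℝ≥0∞} (hφ : Measurable φ) (b : ℝ) :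
    ∫⁻ x in Set.Iio b, φ (Real.exp (-x)) ∂gumbel
      = ∫⁻ u in Set.Ioi (Real.exp (-b)), ENNReal.ofReal (Real.exp (-u)) * φ u := by
  rw [setLIntegral_gumbel_exp_neg hφ measurableSet_Iio]
  congr 2
  ext u
  constructor
  · rintro ⟨x, hx, rfl⟩
    simpa using hx
  · intro hu
    have hu0 : 0 < u := (Real.exp_pos _).trans hu
    refine ⟨-Real.log u, ?_, by simp [Real.exp_log hu0]⟩
    have := (Real.lt_log_iff_exp_lt hu0).2 hu
    simp only [Set.mem_Iio]
    linarith

lemma lintegral_Ioi_exp_neg (a : ℝ) :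
    ∫⁻ u in Set.Ioi a, ENNReal.ofReal (Real.exp (-u)) = ENNReal.ofReal (Real.exp (-a)) := by
  rw [← ofReal_integral_eq_lintegral_ofReal (integrableOn_exp_neg_Ioi a)
    (ae_of_all _ fun x => (Real.exp_pos _).le), integral_exp_neg_Ioi]

/-- Truncating to x < b means conditioning an exponential variable to exceed exp(-b), an event of
probability exp(-exp(-b)); the prefactor is its inverse. By lack of memory, successive arrival times
have exponential gaps. -/
lemma lintegral_truncGumbel_exp_neg {φ : ℝ → ℝ≥0∞} (hφ : Measurable φ) (b : ℝ) :
    ∫⁻ x, φ (Real.exp (-x)) ∂truncGumbel b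
      = ENNReal.ofReal (Real.exp (Real.exp (-b))) *
        ∫⁻ u in Set.Ioi (Real.exp (-b)), ENNReal.ofReal (Real.exp (-u)) * φ u := by
  have h1 : gumbel (Set.Iio b) = ENNReal.ofReal (Real.exp (-Real.exp (-b))) := by
    have := setLIntegral_Iio_gumbel_exp_neg (φ := fun _ => 1) measurable_const b
    simp only [lintegral_const, Measure.restrict_apply_univ, one_mul, mul_one] at this
    rw [this, lintegral_Ioi_exp_neg]
  have h2 : truncGumbel b = gumbel[|Set.Iio b] := rfl
  rw [h2, ProbabilityTheory.cond, lintegral_smul_measure, setLIntegral_Iio_gumbel_exp_neg hφ, h1,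
    Real.exp_neg (Real.exp (-b)), ENNReal.ofReal_inv_of_pos (Real.exp_pos _), inv_inv, smul_eq_mul]

instance : IsProbabilityMeasure gumbelChain := by
  unfold gumbelChain; infer_instance

/-- The Markov property of the arrival times `exp (-G i)`. -/
lemma lintegral_gumbelChain_succ (n : ℕ) {F : (ℕ → ℝ) → ℝ → ℝ≥0∞}
    (hF : Measurable (Function.uncurry F))
    (hdep : ∀ g g' u, (∀ i ≤ n, g i = g' i) → F g u = F g' u) :
    ∫⁻ g, F g (Real.exp (-g (n + 1))) ∂gumbelChain
      = ∫⁻ g, ENNReal.ofReal (Real.exp (Real.exp (-g n))) *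
        (∫⁻ u in Set.Ioi (Real.exp (-g n)), ENNReal.ofReal (Real.exp (-u)) * F g u) ∂gumbelChain := by
  classical
  -- Extending a finite history by zero lets `F` be evaluated on it; by `hdep` the added values are
  -- irrelevant.
  let e : (Finset.Iic n → ℝ) → ℕ → ℝ := fun v i => if h : i ∈ Finset.Iic n then v ⟨i, h⟩ else 0
  have he : Measurable e := by
    refine measurable_pi_lambda _ fun i => ?_
    by_cases h : i ∈ Finset.Iic n
    · simp only [e, h, dite_true]; exact measurable_pi_apply _
    · simp only [e, h, dite_false]; exact measurable_const
  have heF : ∀ (g : ℕ → ℝ) u, F (e (Preorder.frestrictLe n g)) u = F g u := fun g u => by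
    refine hdep _ _ _ fun i hi => ?_
    simp [e, hi, Preorder.frestrictLe]
  have hmeas : Measurable fun p : (Finset.Iic n → ℝ) × ℝ => F (e p.1) (Real.exp (-p.2)) :=
    hF.comp ((he.comp measurable_fst).prodMk (by fun_prop))
  have hκ := Kernel.map_frestrictLe_trajMeasure_compProd_eq_map_trajMeasure
    (X := fun _ => ℝ) (μ₀ := gumbel) (κ := fun n =>
    truncGumbel.comap (fun g : (Finset.Iic n → ℝ) => g ⟨n, Finset.mem_Iic.2 le_rfl⟩)
      (measurable_pi_apply _)) (a := n)
  calc ∫⁻ g, F g (Real.exp (-g (n + 1))) ∂gumbelChain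
      = ∫⁻ g, F (e (Preorder.frestrictLe n g)) (Real.exp (-g (n + 1))) ∂gumbelChain := by
        simp only [heF]
    _ = ∫⁻ p, F (e p.1) (Real.exp (-p.2))
          ∂(gumbelChain.map fun x => (Preorder.frestrictLe (π := fun _ => ℝ) n x, x (n + 1))) := by
        rw [lintegral_map hmeas (by fun_prop)]
    _ = _ := by
        unfold gumbelChain
        rw [← hκ, Measure.lintegral_compProd hmeas, lintegral_map ?_ (by fun_prop)]
        · congr 1 with g
          rw [Kernel.comap_apply]
          have hm : Measurable (F (e (Preorder.frestrictLe n g))) := hF.comp measurable_prodMk_left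
          exact (lintegral_truncGumbel_exp_neg hm _).trans (by simp only [heF]; rfl)
        · exact hmeas.lintegral_kernel_prod_right'

lemma lintegral_gumbelChain_zero {φ : ℝ → ℝ≥0∞} (hφ : Measurable φ) :
    ∫⁻ g, φ (Real.exp (-g 0)) ∂gumbelChain
      = ∫⁻ u in Set.Ioi 0, ENNReal.ofReal (Real.exp (-u)) * φ u := by
  have hmap : gumbelChain.map (fun g => g 0) = gumbel := by
    have h0 : (fun g : ℕ → ℝ => g 0)
        = (fun v : Finset.Iic 0 → ℝ => v ⟨0, Finset.mem_Iic.2 le_rfl⟩) ∘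
          Preorder.frestrictLe (π := fun _ => ℝ) 0 := rfl
    rw [h0, ← Measure.map_map (by fun_prop) (by fun_prop), gumbelChain, Kernel.trajMeasure,
      Measure.map_comp _ _ (by fun_prop), Kernel.traj_map_frestrictLe, Kernel.partialTraj_self,
      Measure.id_comp, Measure.map_map (by fun_prop) (by fun_prop)]
    exact Measure.map_id
  rw [← lintegral_gumbel_exp_neg hφ, ← hmap, lintegral_map (by fun_prop) (by fun_prop)]

lemma ofReal_exp_neg_mul_ofReal_exp (t : ℝ) :
    ENNReal.ofReal (Real.exp (-t)) * ENNReal.ofReal (Real.exp t) = 1 := by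
  rw [← ENNReal.ofReal_mul (Real.exp_pos _).le, ← Real.exp_add]; simp

/-- Given the arrival time number `n`, the earlier ones are distributed as the order statistics of
`n` independent uniform variables. -/
lemma lintegral_gumbelChain_prod (n : ℕ) {Q : ℝ → ℝ → ℝ≥0∞} (hQ : Measurable (Function.uncurry Q))
    {ψ : ℝ → ℝ≥0∞} (hψ : Measurable ψ) :
    ∫⁻ g, ψ (Real.exp (-g n)) *
        ∏ i ∈ Finset.range n, Q (Real.exp (-g i)) (Real.exp (-g n)) ∂gumbelChain
      = ∫⁻ t in Set.Ioi 0, ENNReal.ofReal (Real.exp (-t)) *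
          (ψ t * ((∫⁻ v in Set.Ioo 0 t, Q v t) ^ n / n.factorial)) := by
  induction n generalizing Q ψ with
  | zero => simpa using lintegral_gumbelChain_zero hψ
  | succ n ih =>
    have hQ' : ∀ {α : Type} [MeasurableSpace α] {a b : α → ℝ}, Measurable a → Measurable b →
      Measurable fun x => Q (a x) (b x) := fun ha hb => hQ.comp (ha.prodMk hb)
    let F : (ℕ → ℝ) → ℝ → ℝ≥0∞ := fun g u => ψ u * ∏ i ∈ Finset.range (n + 1), Q (Real.exp (-g i)) u
    have hF : Measurable (Function.uncurry F) :=
      (hψ.comp measurable_snd).mul (Finset.measurable_prod _ fun i _ =>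
        hQ' (by fun_prop) measurable_snd)
    have hF' : Measurable fun p : (ℕ → ℝ) × ℝ => F p.1 p.2 := hF
    have hstep := lintegral_gumbelChain_succ n hF (fun g g' u h => by
      simp only [F]
      congr 1
      refine Finset.prod_congr rfl fun i hi => ?_
      rw [h i (by simpa [Nat.lt_succ_iff] using hi)])
    refine hstep.trans ?_
    -- With the last arrival frozen at u, its transition density from t (on t < u) and all factors
    -- involving it form a new weight for arrival number n, to which the induction hypothesis
    -- applies.
    let φ : ℝ → ℝ → ℝ≥0∞ := fun u => (Set.Iio u).indicator fun t =>
      ENNReal.ofReal (Real.exp t) * (ENNReal.ofReal (Real.exp (-u)) * (ψ u * Q t u))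
    have hφ : ∀ u, Measurable (φ u) := fun u => by
      refine Measurable.indicator ?_ measurableSet_Iio
      have := hQ' measurable_id (measurable_const (a := u))
      simp only [id] at this
      fun_prop
    have h1 : ∀ g : ℕ → ℝ, ENNReal.ofReal (Real.exp (Real.exp (-g n))) *
        (∫⁻ u in Set.Ioi (Real.exp (-g n)), ENNReal.ofReal (Real.exp (-u)) * F g u)
        = ∫⁻ u in Set.Ioi 0, φ u (Real.exp (-g n)) * ∏ i ∈ Finset.range n, Q (Real.exp (-g i)) u := by
      intro g
      have hFg : Measurable (F g) := hF.comp measurable_prodMk_left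
      rw [← lintegral_const_mul _ (by fun_prop), ← lintegral_indicator measurableSet_Ioi,
        ← lintegral_indicator measurableSet_Ioi]
      congr 1 with u
      by_cases hu : Real.exp (-g n) < u
      · have hu0 : 0 < u := (Real.exp_pos _).trans hu
        rw [Set.indicator_of_mem (show u ∈ Set.Ioi _ from hu),
          Set.indicator_of_mem (show u ∈ Set.Ioi 0 from hu0)]
        simp only [φ, F, Set.indicator_of_mem (show Real.exp (-g n) ∈ Set.Iio u from hu),
          Finset.prod_range_succ]
        ring
      · rw [Set.indicator_of_notMem (show u ∉ Set.Ioi _ from hu)]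
        by_cases hu0 : 0 < u
        · rw [Set.indicator_of_mem (show u ∈ Set.Ioi 0 from hu0)]
          simp only [φ, Set.indicator_of_notMem (show Real.exp (-g n) ∉ Set.Iio u from hu), zero_mul]
        · rw [Set.indicator_of_notMem (show u ∉ Set.Ioi 0 from hu0)]
    simp_rw [h1]
    rw [lintegral_lintegral_swap]
    · refine setLIntegral_congr_fun measurableSet_Ioi fun u hu => ?_
      have hu1 : Measurable fun t => Q t u := hQ' measurable_id measurable_const
      have := ih (Q := fun t _ => Q t u) (ψ := φ u) (hu1.comp measurable_fst) (hφ u)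
      refine this.trans ?_
      rw [← lintegral_mul_primitive_pow_div_factorial hu1, ← mul_assoc, ← lintegral_const_mul]
      · rw [← Set.Ioi_inter_Iio, Set.inter_comm, ← setLIntegral_indicator measurableSet_Iio]
        congr 1 with t
        by_cases ht : t < u
        · simp only [φ, Set.indicator_of_mem (show t ∈ Set.Iio u from ht)]
          simp only [← mul_assoc]
          rw [ofReal_exp_neg_mul_ofReal_exp, one_mul]
        · simp only [φ, Set.indicator_of_notMem (show t ∉ Set.Iio u from ht), zero_mul, mul_zero]
      · refine hu1.mul (Measurable.div_const (Measurable.pow_const ?_ _) _)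
        exact measurable_lintegral_Ioo (f := fun _ v => Q v u) (hu1.comp measurable_snd)
          measurable_const measurable_id
    · refine Measurable.aemeasurable (Measurable.mul ?_ (Finset.measurable_prod _ fun i _ =>
        hQ' (by fun_prop) measurable_snd))
      have hs : MeasurableSet {p : (ℕ → ℝ) × ℝ | Real.exp (-p.1 n) < p.2} :=
        measurableSet_lt (by fun_prop) measurable_snd
      have : Measurable fun p : (ℕ → ℝ) × ℝ => ENNReal.ofReal (Real.exp (Real.exp (-p.1 n))) *
          (ENNReal.ofReal (Real.exp (-p.2)) * (ψ p.2 * Q (Real.exp (-p.1 n)) p.2)) := by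
        have := hQ' (α := (ℕ → ℝ) × ℝ) (a := fun p => Real.exp (-p.1 n)) (b := fun p => p.2)
          (by fun_prop) (by fun_prop)
        fun_prop
      exact this.indicator hs

/-- The expectation of `∑ j < n + 1, ψ (T j) (T (n + 1)) * ∏ i ≠ j, Q (T i) (T j)`, the sum being
over the arrival times before `T (n + 1)`. -/
lemma lintegral_gumbelChain_sum_prod (n : ℕ) {Q : ℝ → ℝ → ℝ≥0∞}
    (hQ : Measurable (Function.uncurry Q)) {ψ : ℝ → ℝ → ℝ≥0∞}
    (hψ : Measurable (Function.uncurry ψ)) :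
    ∫⁻ g, ∑ j ∈ Finset.range (n + 1), ψ (Real.exp (-g j)) (Real.exp (-g (n + 1))) *
        ∏ i ∈ Finset.range (n + 1),
          (if i = j then 1 else Q (Real.exp (-g i)) (Real.exp (-g j))) ∂gumbelChain
      = ∫⁻ τ in Set.Ioi 0, ∫⁻ t in Set.Ioi τ, ENNReal.ofReal (Real.exp (-t)) *
          (ψ τ t * ((∫⁻ v in Set.Ioo 0 t, Q v τ) ^ n / n.factorial)) := by
  have hQ' : ∀ {α : Type} [MeasurableSpace α] {a b : α → ℝ}, Measurable a → Measurable b →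
    Measurable fun x => Q (a x) (b x) := fun ha hb => hQ.comp (ha.prodMk hb)
  have hψ' : ∀ {ψ : ℝ → ℝ → ℝ≥0∞}, Measurable (Function.uncurry ψ) →
    ∀ {α : Type} [MeasurableSpace α] {a b : α → ℝ}, Measurable a → Measurable b →
    Measurable fun x => ψ (a x) (b x) := fun h _ _ _ _ ha hb => h.comp (ha.prodMk hb)
  have hW : ∀ {ψ : ℝ → ℝ → ℝ≥0∞}, Measurable (Function.uncurry ψ) → Measurable fun p : ℝ × ℝ =>
      ENNReal.ofReal (Real.exp p.2) *
        ∫⁻ u in Set.Ioi p.2, ENNReal.ofReal (Real.exp (-u)) * ψ p.1 u := by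
    intro ψ hψ
    refine Measurable.mul (by fun_prop) (measurable_lintegral_Ioi (α := ℝ × ℝ)
      (f := fun p u => ENNReal.ofReal (Real.exp (-u)) * ψ p.1 u) ?_ measurable_snd)
    exact Measurable.mul (by fun_prop) (hψ' hψ (by fun_prop) (by fun_prop))
  have hstep : ∀ (n : ℕ) {ψ : ℝ → ℝ → ℝ≥0∞}, Measurable (Function.uncurry ψ) →
      ∫⁻ g, ∑ j ∈ Finset.range (n + 1), ψ (Real.exp (-g j)) (Real.exp (-g (n + 1))) *
        ∏ i ∈ Finset.range (n + 1),
          (if i = j then 1 else Q (Real.exp (-g i)) (Real.exp (-g j))) ∂gumbelChain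
      = ∫⁻ g, (∑ j ∈ Finset.range n, (Q (Real.exp (-g n)) (Real.exp (-g j)) *
          (ENNReal.ofReal (Real.exp (Real.exp (-g n))) *
            ∫⁻ u in Set.Ioi (Real.exp (-g n)),
              ENNReal.ofReal (Real.exp (-u)) * ψ (Real.exp (-g j)) u)) *
          ∏ i ∈ Finset.range n,
            (if i = j then 1 else Q (Real.exp (-g i)) (Real.exp (-g j)))) ∂gumbelChain
        + ∫⁻ t in Set.Ioi 0, (∫⁻ u in Set.Ioi t, ENNReal.ofReal (Real.exp (-u)) * ψ t u) *
            ((∫⁻ v in Set.Ioo 0 t, Q v t) ^ n / n.factorial) := by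
    -- Integrating out arrival n + 1 replaces ψ by W. The summand j = n is then covered by
    -- `lintegral_gumbelChain_prod`; the summands j < n keep the shape of the claim with one arrival
    -- fewer.
    intro n ψ hψ
    let C : (ℕ → ℝ) → ℕ → ℕ → ℝ≥0∞ := fun g m j => ∏ i ∈ Finset.range m,
      (if i = j then 1 else Q (Real.exp (-g i)) (Real.exp (-g j)))
    have hC : ∀ m j, Measurable fun g => C g m j := fun m j => by
      refine Finset.measurable_prod _ fun i _ => ?_
      by_cases h : i = j
      · simp only [h, if_true]; exact measurable_const
      · simp only [h, if_false]; exact hQ' (by fun_prop) (by fun_prop)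
    let W : ℝ → ℝ → ℝ≥0∞ := fun τ t => ENNReal.ofReal (Real.exp t) *
      ∫⁻ u in Set.Ioi t, ENNReal.ofReal (Real.exp (-u)) * ψ τ u
    have hWm : Measurable (Function.uncurry W) := hW hψ
    have hF : Measurable (Function.uncurry fun (g : ℕ → ℝ) u =>
        ∑ j ∈ Finset.range (n + 1), ψ (Real.exp (-g j)) u * C g (n + 1) j) := by
      refine Finset.measurable_sum _ fun j _ => Measurable.mul ?_ ((hC _ _).comp measurable_fst)
      exact hψ' hψ (by fun_prop) measurable_snd
    have hM := lintegral_gumbelChain_succ n hF (fun g g' u h => by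
      refine Finset.sum_congr rfl fun j hj => ?_
      have hj' := h j (by simpa [Nat.lt_succ_iff] using hj)
      rw [hj']
      congr 1
      refine Finset.prod_congr rfl fun i hi => ?_
      rw [h i (by simpa [Nat.lt_succ_iff] using hi), hj'])
    refine hM.trans ?_
    have hpull : ∀ g : ℕ → ℝ, ENNReal.ofReal (Real.exp (Real.exp (-g n))) *
        (∫⁻ u in Set.Ioi (Real.exp (-g n)), ENNReal.ofReal (Real.exp (-u)) *
          ∑ j ∈ Finset.range (n + 1), ψ (Real.exp (-g j)) u * C g (n + 1) j)
        = (∑ j ∈ Finset.range n, (Q (Real.exp (-g n)) (Real.exp (-g j)) *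
            W (Real.exp (-g j)) (Real.exp (-g n))) * C g n j)
          + W (Real.exp (-g n)) (Real.exp (-g n)) *
            ∏ i ∈ Finset.range n, Q (Real.exp (-g i)) (Real.exp (-g n)) := by
      intro g
      have hψg : ∀ j, Measurable (ψ (Real.exp (-g j))) := fun j => hψ.comp measurable_prodMk_left
      simp_rw [Finset.mul_sum]
      rw [lintegral_finsetSum _ (fun j _ => by have := hψg j; fun_prop), Finset.mul_sum,
        Finset.sum_range_succ]
      have hj : ∀ j, ENNReal.ofReal (Real.exp (Real.exp (-g n))) *
          (∫⁻ u in Set.Ioi (Real.exp (-g n)), ENNReal.ofReal (Real.exp (-u)) *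
            (ψ (Real.exp (-g j)) u * C g (n + 1) j))
          = W (Real.exp (-g j)) (Real.exp (-g n)) * C g (n + 1) j := by
        intro j
        have := hψg j
        simp_rw [← mul_assoc]
        rw [lintegral_mul_const _ (by fun_prop), ← mul_assoc]
      rw [hj]
      congr 1
      · refine Finset.sum_congr rfl fun j hjn => ?_
        have hne : n ≠ j := (Finset.mem_range.1 hjn).ne'
        rw [hj]
        simp only [C, Finset.prod_range_succ, hne, if_false]
        ring
      · simp only [C, Finset.prod_range_succ, if_true, mul_one]
        congr 1
        refine Finset.prod_congr rfl fun i hi => ?_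
        rw [if_neg (Finset.mem_range.1 hi).ne]
    have hd : Measurable fun t => W t t := hψ' hWm measurable_id measurable_id
    simp_rw [hpull]
    rw [lintegral_add_right]
    · congr 1
      refine (lintegral_gumbelChain_prod n hQ hd).trans ?_
      refine setLIntegral_congr_fun measurableSet_Ioi fun t _ => ?_
      simp only [W, ← mul_assoc]
      rw [ofReal_exp_neg_mul_ofReal_exp, one_mul]
    · exact (hd.comp (g := fun t => W t t) (f := fun g : ℕ → ℝ => Real.exp (-g n))
        (by fun_prop)).mul (Finset.measurable_prod _ fun i _ => hQ' (by fun_prop) (by fun_prop))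
  induction n generalizing ψ with
  | zero =>
    rw [hstep 0 hψ]
    simp only [Finset.range_zero, Finset.sum_empty, lintegral_zero, zero_add, pow_zero,
      Nat.factorial_zero, Nat.cast_one, div_one, mul_one]
  | succ n ih =>
    rw [hstep (n + 1) hψ]
    -- The factor by which arrival n + 1 loses to the distinguished arrival τ is absorbed into the
    -- weight.
    have h1 := ih (ψ := fun τ t => Q t τ * (ENNReal.ofReal (Real.exp t) *
        ∫⁻ u in Set.Ioi t, ENNReal.ofReal (Real.exp (-u)) * ψ τ u))
      ((hQ' measurable_snd measurable_fst).mul (hW hψ))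
    rw [h1, ← lintegral_add_right]
    · refine setLIntegral_congr_fun measurableSet_Ioi fun τ hτ => ?_
      have hq : Measurable fun t => Q t τ := hQ' measurable_id measurable_const
      have hψτ : Measurable (ψ τ) := hψ.comp measurable_prodMk_left
      have hH : Measurable fun t : ℝ => ∫⁻ v in Set.Ioo 0 t, Q v τ :=
        measurable_lintegral_Ioo (f := fun _ v => Q v τ) (hq.comp measurable_snd)
          measurable_const measurable_id
      have hqH : Measurable fun t => Q t τ * ((∫⁻ v in Set.Ioo 0 t, Q v τ) ^ n / n.factorial) :=
        hq.mul ((hH.pow_const n).div_const _)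
      have heψ : Measurable fun u => ENNReal.ofReal (Real.exp (-u)) * ψ τ u := by fun_prop
      have hsw := lintegral_Ioi_Ioo_swap τ (f := fun t u =>
        (Q t τ * ((∫⁻ v in Set.Ioo 0 t, Q v τ) ^ n / n.factorial)) *
          (ENNReal.ofReal (Real.exp (-u)) * ψ τ u))
        ((hqH.comp measurable_fst).mul (heψ.comp measurable_snd))
      simp_rw [lintegral_const_mul _ heψ, lintegral_mul_const _ hqH] at hsw
      have h2 : ∫⁻ t in Set.Ioi τ, ENNReal.ofReal (Real.exp (-t)) *
          (Q t τ * (ENNReal.ofReal (Real.exp t) *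
            ∫⁻ u in Set.Ioi t, ENNReal.ofReal (Real.exp (-u)) * ψ τ u) *
            ((∫⁻ v in Set.Ioo 0 t, Q v τ) ^ n / n.factorial))
          = ∫⁻ t in Set.Ioi τ, Q t τ * ((∫⁻ v in Set.Ioo 0 t, Q v τ) ^ n / n.factorial) *
            ∫⁻ u in Set.Ioi t, ENNReal.ofReal (Real.exp (-u)) * ψ τ u := by
        refine setLIntegral_congr_fun measurableSet_Ioi fun t _ => ?_
        have hr : ∀ a b q I H : ℝ≥0∞, a * (q * (b * I) * H) = a * b * (q * H * I) :=
          fun a b q I H => by ring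
        rw [hr, ofReal_exp_neg_mul_ofReal_exp, one_mul]
      rw [h2, ← hsw, ← lintegral_mul_const _ heψ, ← lintegral_add_right _ (heψ.mul_const _)]
      -- The latest of the other arrivals lies in (τ, u) when τ is not the last of the group, and in
      -- (0, τ) when it is; the two ranges add up to (0, u).
      refine setLIntegral_congr_fun measurableSet_Ioi fun u hu => ?_
      rw [← lintegral_mul_primitive_pow_div_factorial hq n u,
        ← lintegral_mul_primitive_pow_div_factorial hq n τ,
        ← lintegral_Ioo_add_lintegral_Ioo _ (le_of_lt hτ) hu]
      ring
    · refine Measurable.mul ?_ (Measurable.div_const (Measurable.pow_const ?_ _) _)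
      · exact measurable_lintegral_Ioi (f := fun t u => ENNReal.ofReal (Real.exp (-u)) * ψ t u)
          (Measurable.mul (by fun_prop) hψ) measurable_id
      · exact measurable_lintegral_Ioo (f := fun t v => Q v t)
          (hQ' measurable_snd measurable_fst) measurable_const measurable_id

/-! ### Lower bound for the mean number of winning arrivals -/

/-- For fixed x the condition holds for all v in (ρ(x) τ/Y, t), a set of length at least t - ρ(x)
τ/Y; averaging over x with mean of ρ at most 1 gives the bound. -/
lemma ofReal_le_lintegral_measure_lt_add {Ω : Type*} [MeasurableSpace Ω] (P : Measure Ω)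
    [IsProbabilityMeasure P] {ρ : Ω → ℝ≥0∞} (hρ : Measurable ρ) (hρ1 : ∫⁻ x, ρ x ∂P ≤ 1)
    {Y τ : ℝ} (hY : 0 < Y) (hτ : 0 < τ) (t : ℝ) :
    ENNReal.ofReal t ≤ (∫⁻ v in Set.Ioo 0 t, P {x | ρ x < ENNReal.ofReal (v / τ) * ENNReal.ofReal Y})
      + ENNReal.ofReal (τ / Y) := by
  have hs : MeasurableSet {p : ℝ × Ω | ρ p.2 < ENNReal.ofReal (p.1 / τ) * ENNReal.ofReal Y} :=
    measurableSet_lt (by fun_prop) (by fun_prop)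
  have hsw : ∫⁻ v in Set.Ioo 0 t, P {x | ρ x < ENNReal.ofReal (v / τ) * ENNReal.ofReal Y}
      = ∫⁻ x, volume.restrict (Set.Ioo 0 t)
          {v | ρ x < ENNReal.ofReal (v / τ) * ENNReal.ofReal Y} ∂P := by
    have h1 := Measure.prod_apply (μ := volume.restrict (Set.Ioo 0 t)) (ν := P) hs
    have h2 := Measure.prod_apply_symm (μ := volume.restrict (Set.Ioo 0 t)) (ν := P) hs
    exact h1.symm.trans h2
  have hpt : ∀ x, ENNReal.ofReal t ≤ volume.restrict (Set.Ioo 0 t)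
      {v | ρ x < ENNReal.ofReal (v / τ) * ENNReal.ofReal Y} + ρ x * ENNReal.ofReal (τ / Y) := by
    intro x
    by_cases hx : ρ x = ∞
    · rw [hx, ENNReal.top_mul (by simpa using div_pos hτ hY)]
      simp
    · lift ρ x to NNReal using hx with a
      have ha : (a : ℝ≥0∞) = ENNReal.ofReal (a : ℝ) := by simp
      have hsub : Set.Ioo (a * (τ / Y)) t ⊆
          {v | (a : ℝ≥0∞) < ENNReal.ofReal (v / τ) * ENNReal.ofReal Y} ∩ Set.Ioo 0 t := by
        intro v hv
        have hv0 : 0 < v := lt_of_le_of_lt (by positivity) hv.1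
        refine ⟨?_, hv0, hv.2⟩
        rw [Set.mem_ofPred_eq, ← ENNReal.ofReal_mul (by positivity), ha,
          ENNReal.ofReal_lt_ofReal_iff (by positivity)]
        have := hv.1
        rw [div_mul_eq_mul_div, lt_div_iff₀ hτ]
        rwa [← mul_div_assoc, div_lt_iff₀ hY] at this
      calc ENNReal.ofReal t ≤ ENNReal.ofReal (t - a * (τ / Y)) + ENNReal.ofReal (a * (τ / Y)) := by
            refine le_trans (ENNReal.ofReal_le_ofReal ?_) ENNReal.ofReal_add_le
            rw [sub_add_cancel]
        _ ≤ _ := by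
            gcongr
            · rw [← Real.volume_Ioo, Measure.restrict_apply' measurableSet_Ioo]
              exact measure_mono hsub
            · rw [ENNReal.ofReal_mul NNReal.zero_le_coe, ← ha]
  calc ENNReal.ofReal t = ∫⁻ _, ENNReal.ofReal t ∂P := by simp
    _ ≤ ∫⁻ x, (volume.restrict (Set.Ioo 0 t)
      {v | ρ x < ENNReal.ofReal (v / τ) * ENNReal.ofReal Y} + ρ x * ENNReal.ofReal (τ / Y)) ∂P :=
        lintegral_mono hpt
    _ ≤ _ := by
        rw [lintegral_add_right _ (by fun_prop), hsw, lintegral_mul_const _ hρ]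
        gcongr
        exact mul_le_of_le_one_left' hρ1

lemma lintegral_exp_neg_mul_pow_div_factorial (n : ℕ) :
    ∫⁻ t in Set.Ioi (0 : ℝ), ENNReal.ofReal (Real.exp (-t)) *
      (ENNReal.ofReal t ^ n / n.factorial) = 1 := by
  -- With trivial weights the law of an arrival time is the Gamma law, whose total mass is 1.
  have h := lintegral_gumbelChain_prod n (Q := fun _ _ => 1) (ψ := fun _ => 1)
    measurable_const measurable_const
  simpa using h.symm

/-- The bound m ≤ Y keeps t - τ/Y nonnegative on the range of integration, so `ENNReal.ofReal` does
not truncate and the explicit primitive applies. -/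
lemma lintegral_pow_sub_div {Y : ℝ} (hY : 0 < Y) {m : ℝ} (hm0 : 0 ≤ m) (hmY : m ≤ Y) (n : ℕ)
    {t : ℝ} (ht : 0 < t) :
    ∫⁻ τ in Set.Ioo 0 (m * t), ENNReal.ofReal (t - τ / Y) ^ n / n.factorial
      = ENNReal.ofReal (Y * (1 - (1 - m / Y) ^ (n + 1))) *
        (ENNReal.ofReal t ^ (n + 1) / (n + 1).factorial) := by
  have hnn : ∀ τ ∈ Set.Ioo 0 (m * t), 0 ≤ t - τ / Y := by
    intro τ hτ
    rw [sub_nonneg, div_le_iff₀ hY, mul_comm]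
    exact hτ.2.le.trans (by gcongr)
  have hfac : ∀ (a : ℝ), 0 ≤ a → ∀ n : ℕ, ENNReal.ofReal a ^ n / n.factorial
      = ENNReal.ofReal (a ^ n / n.factorial) := by
    intro a ha n
    rw [ENNReal.ofReal_div_of_pos (by positivity), ENNReal.ofReal_pow ha, ENNReal.ofReal_natCast]
  have hc : Continuous fun τ : ℝ => (t - τ / Y) ^ n / n.factorial := by fun_prop
  have hderiv : ∀ τ : ℝ, HasDerivAt (fun τ => -(Y * (t - τ / Y) ^ (n + 1) / (n + 1).factorial))
      ((t - τ / Y) ^ n / n.factorial) τ := by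
    intro τ
    have h := ((((hasDerivAt_id τ).div_const Y).const_sub t).pow (n + 1)).const_mul Y
      |>.div_const ((n + 1).factorial : ℝ) |>.neg
    refine h.congr_deriv ?_
    have : ((n.factorial : ℝ)) ≠ 0 := by positivity
    rw [Nat.factorial_succ]
    push_cast
    simp only [id]
    field_simp
  have hint : ∫ τ in Set.Ioo 0 (m * t), (t - τ / Y) ^ n / n.factorial
      = Y * (1 - (1 - m / Y) ^ (n + 1)) * (t ^ (n + 1) / (n + 1).factorial) := by
    rw [← integral_Ioc_eq_integral_Ioo, ← intervalIntegral.integral_of_le (by positivity),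
      intervalIntegral.integral_eq_sub_of_hasDerivAt (fun τ _ => hderiv τ)
        (hc.intervalIntegrable _ _)]
    have : t - m * t / Y = t * (1 - m / Y) := by ring
    rw [this, mul_pow]
    ring
  have h1 : m / Y ≤ 1 := (div_le_one hY).2 hmY
  have h2 : 0 ≤ Y * (1 - (1 - m / Y) ^ (n + 1)) :=
    mul_nonneg hY.le (sub_nonneg.2 (pow_le_one₀ (by linarith) (by linarith [div_nonneg hm0 hY.le])))
  rw [setLIntegral_congr_fun measurableSet_Ioo (fun τ hτ => hfac _ (hnn τ hτ) n),
    hfac t ht.le, ← ENNReal.ofReal_mul h2, ← hint, ofReal_integral_eq_lintegral_ofReal]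
  · exact (hc.integrableOn_Icc (a := 0) (b := m * t)).mono_set Set.Ioo_subset_Icc_self
  · filter_upwards [ae_restrict_mem measurableSet_Ioo] with τ hτ
    have := hnn τ hτ
    positivity

/-- The mean number of the first `n + 1` arrivals `j` for which a proposal with density ratio `Y`
beats all competitors. -/
lemma le_lintegral_gumbelChain_sum_prod {Ω : Type*} [MeasurableSpace Ω] (P : Measure Ω)
    [IsProbabilityMeasure P] {ρ : Ω → ℝ≥0∞} (hρ : Measurable ρ) (hρ1 : ∫⁻ x, ρ x ∂P ≤ 1)
    {Y : ℝ} (hY : 0 < Y) (n : ℕ) :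
    ENNReal.ofReal (Y * (1 - (1 - min 1 Y / Y) ^ (n + 1))) ≤
      ∫⁻ g, ∑ j ∈ Finset.range (n + 1), ∏ i ∈ Finset.range (n + 1), (if i = j then 1 else
        P {x | ρ x < ENNReal.ofReal (Real.exp (-g i) / Real.exp (-g j)) * ENNReal.ofReal Y})
          ∂gumbelChain := by
  have hQ : Measurable (Function.uncurry fun v τ : ℝ =>
      P {x | ρ x < ENNReal.ofReal (v / τ) * ENNReal.ofReal Y}) := by
    have hs : MeasurableSet {p : (ℝ × ℝ) × Ω |
        ρ p.2 < ENNReal.ofReal (p.1.1 / p.1.2) * ENNReal.ofReal Y} :=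
      measurableSet_lt (by fun_prop) (by fun_prop)
    exact measurable_measure_prodMk_left hs
  have h := lintegral_gumbelChain_sum_prod n hQ (ψ := fun _ _ => 1) measurable_const
  simp only [one_mul] at h
  rw [h]
  have hH : Measurable fun p : ℝ × ℝ => ∫⁻ v in Set.Ioo 0 p.2,
      P {x | ρ x < ENNReal.ofReal (v / p.1) * ENNReal.ofReal Y} :=
    measurable_lintegral_Ioo (f := fun (p : ℝ × ℝ) v =>
      P {x | ρ x < ENNReal.ofReal (v / p.1) * ENNReal.ofReal Y})
      (hQ.comp (measurable_snd.prodMk (measurable_fst.comp measurable_fst)))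
      measurable_const measurable_snd
  rw [← lintegral_Ioi_Ioo_swap 0 (Measurable.mul (by fun_prop)
    ((hH.pow_const n).div_const _))]
  -- The cutoff τ < min(1, Y) t stays inside the range τ < t and inside the region where t - τ/Y is
  -- nonnegative.
  have hm0 : 0 < min 1 Y := lt_min one_pos hY
  calc ENNReal.ofReal (Y * (1 - (1 - min 1 Y / Y) ^ (n + 1)))
      = ∫⁻ t in Set.Ioi (0 : ℝ), ENNReal.ofReal (Y * (1 - (1 - min 1 Y / Y) ^ (n + 1))) *
          (ENNReal.ofReal (Real.exp (-t)) *
            (ENNReal.ofReal t ^ (n + 1) / (n + 1).factorial)) := by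
        rw [lintegral_const_mul _ (by fun_prop), lintegral_exp_neg_mul_pow_div_factorial, mul_one]
    _ ≤ _ := by
        refine setLIntegral_mono' measurableSet_Ioi fun t ht => ?_
        rw [mul_left_comm, ← lintegral_pow_sub_div hY hm0.le (min_le_right _ _) n ht,
          ← lintegral_const_mul _ (by fun_prop)]
        refine (setLIntegral_mono' measurableSet_Ioo fun τ hτ => ?_).trans
          (lintegral_mono_set (Set.Ioo_subset_Ioo_right ?_))
        · gcongr
          rw [ENNReal.ofReal_sub _ (div_nonneg hτ.1.le hY.le), tsub_le_iff_right]
          exact ofReal_le_lintegral_measure_lt_add P hρ hρ1 hY hτ.1 t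
        · exact mul_le_of_le_one_left (le_of_lt ht) (min_le_left _ _)

/-! ### Runs of the algorithm -/

/-- The quantity which the algorithm maximises. -/
noncomputable def score {Ω : Type*} (r : Ω → ℝ≥0∞) (x : Ω) (g : ℝ) : EReal :=
  ENNReal.log (r x) + (g : EReal)

lemma depthLimitedAStar_N_le {Ω : Type*} (r : Ω → ℝ≥0∞) (x : ℕ → Ω) (g : ℕ → ℝ) (k : ℕ) :
    (depthLimitedAStar r x g k).N ≤ k := by
  induction k with
  | zero => simp [depthLimitedAStar]
  | succ k ih =>
    simp only [depthLimitedAStar, State.step]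
    split_ifs
    · exact le_rfl
    · exact ih.trans (Nat.le_succ k)

/-- Before round j the record `L` is below the score of j, so round j overwrites it; afterwards no
score exceeds it. -/
lemma depthLimitedAStar_Y_of_score_lt {Ω : Type*} (r : Ω → ℝ≥0∞) (x : ℕ → Ω) (g : ℕ → ℝ)
    {j k : ℕ} (hjk : j < k) (hj : ⊥ < score r (x j) (g j))
    (hlt : ∀ i < k, i ≠ j → score r (x i) (g i) < score r (x j) (g j)) :
    (depthLimitedAStar r x g k).Y = Sum.inl (x j) := by
  have hbefore : ∀ m ≤ j, (depthLimitedAStar r x g m).L < score r (x j) (g j) := by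
    intro m hm
    induction m with
    | zero => exact hj
    | succ m ih =>
      simp only [depthLimitedAStar, State.step]
      split_ifs
      · exact hlt m (by omega) (by omega)
      · exact ih (by omega)
  have hafter : ∀ m, j < m → m ≤ k → (depthLimitedAStar r x g m).Y = Sum.inl (x j) ∧
      (depthLimitedAStar r x g m).L = score r (x j) (g j) := by
    intro m hm
    induction m, hm using Nat.le_induction with
    | base =>
      intro _
      have : (depthLimitedAStar r x g j).L < ENNReal.log (r (x j)) + (g j : EReal) :=
        hbefore j le_rfl
      simp only [depthLimitedAStar, State.step]
      rw [if_pos this]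
      exact ⟨rfl, rfl⟩
    | succ m hm ih =>
      intro hmk
      obtain ⟨h1, h2⟩ := ih (by omega)
      have h3 := hlt m (by omega) (by omega)
      simp only [depthLimitedAStar, State.step]
      rw [if_neg (by rw [h2]; exact not_lt.2 h3.le)]
      exact ⟨h1, h2⟩
  exact (hafter k hjk le_rfl).1

lemma measurable_score {Ω : Type*} [MeasurableSpace Ω] {r : Ω → ℝ≥0∞} (hr : Measurable r) :
    Measurable fun p : Ω × ℝ => score r p.1 p.2 := by
  unfold score
  exact (ENNReal.measurable_log.comp (hr.comp measurable_fst)).add measurable_snd.coe_real_ereal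

lemma measurable_depthLimitedAStar_Y {Ω : Type*} [MeasurableSpace Ω] {r : Ω → ℝ≥0∞}
    (hr : Measurable r) (k : ℕ) :
    Measurable fun p : (ℕ → Ω) × (ℕ → ℝ) => (depthLimitedAStar r p.1 p.2 k).Y := by
  suffices h : (Measurable fun p : (ℕ → Ω) × (ℕ → ℝ) => (depthLimitedAStar r p.1 p.2 k).Y) ∧
      Measurable fun p : (ℕ → Ω) × (ℕ → ℝ) => (depthLimitedAStar r p.1 p.2 k).L from h.1
  induction k with
  | zero => exact ⟨measurable_const, measurable_const⟩
  | succ k ih =>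
    obtain ⟨hY, hL⟩ := ih
    have hx : Measurable fun p : (ℕ → Ω) × (ℕ → ℝ) => p.1 k := by fun_prop
    have hs : Measurable fun p : (ℕ → Ω) × (ℕ → ℝ) => score r (p.1 k) (p.2 k) :=
      (measurable_score hr).comp (hx.prodMk (by fun_prop))
    have hset := measurableSet_lt hL hs
    have hstep : ∀ p : (ℕ → Ω) × (ℕ → ℝ), depthLimitedAStar r p.1 p.2 (k + 1)
        = if (depthLimitedAStar r p.1 p.2 k).L < score r (p.1 k) (p.2 k) then
          ⟨k + 1, Sum.inl (p.1 k), score r (p.1 k) (p.2 k)⟩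
        else depthLimitedAStar r p.1 p.2 k := fun p => rfl
    simp only [hstep, apply_ite State.Y, apply_ite State.L]
    exact ⟨Measurable.ite hset (measurable_inl.comp hx) hY, Measurable.ite hset hs hL⟩

lemma bot_lt_score {Ω : Type*} {r : Ω → ℝ≥0∞} {x : Ω} (h : r x ≠ 0) (g : ℝ) :
    ⊥ < score r x g := by
  rw [bot_lt_iff_ne_bot, score, Ne, EReal.add_eq_bot_iff]
  simp [h]

/-- A score is the logarithm of r(x)/exp(-g), so the hypothesis is the comparison of these quotients
with one denominator moved across. The case r x = 0, of score ⊥, needs no real logarithm. -/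
lemma score_lt_score {Ω : Type*} {r : Ω → ℝ≥0∞} {x y : Ω} {g h : ℝ} (hy0 : r y ≠ 0)
    (hy : r y ≠ ∞)
    (hlt : r x < ENNReal.ofReal (Real.exp (-g) / Real.exp (-h)) * r y) :
    score r x g < score r y h := by
  by_cases hx0 : r x = 0
  · refine lt_of_eq_of_lt ?_ (bot_lt_score hy0 h)
    simp [score, hx0]
  have hx : r x ≠ ∞ := hlt.ne_top
  obtain ⟨a, ha, hxa⟩ : ∃ a : ℝ, 0 < a ∧ r x = ENNReal.ofReal a :=
    ⟨_, ENNReal.toReal_pos hx0 hx, (ENNReal.ofReal_toReal hx).symm⟩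
  obtain ⟨b, hb, hyb⟩ : ∃ b : ℝ, 0 < b ∧ r y = ENNReal.ofReal b :=
    ⟨_, ENNReal.toReal_pos hy0 hy, (ENNReal.ofReal_toReal hy).symm⟩
  rw [hxa, hyb, ← ENNReal.ofReal_mul (by positivity),
    ENNReal.ofReal_lt_ofReal_iff (by positivity)] at hlt
  rw [score, score, hxa, hyb, ENNReal.log_ofReal_of_pos ha, ENNReal.log_ofReal_of_pos hb,
    ← EReal.coe_add, ← EReal.coe_add, EReal.coe_lt_coe_iff]
  have := Real.log_lt_log ha hlt
  rw [Real.log_mul (by positivity) hb.ne', Real.log_div (by positivity) (by positivity),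
    Real.log_exp, Real.log_exp] at this
  linarith

/-! ### The probability that a proposal wins -/

/-- Fubini with coordinate j singled out: once its value y is fixed, the conditions on the other
coordinates are independent. -/
lemma pi_setOf_forall_ne {Ω : Type*} [MeasurableSpace Ω] (P : Measure Ω) [IsProbabilityMeasure P]
    {n : ℕ} (j : Fin (n + 1)) {A : Set Ω} (hA : MeasurableSet A) {R : Fin (n + 1) → Set (Ω × Ω)}
    (hR : ∀ i, MeasurableSet (R i)) :
    Measure.pi (fun _ : Fin (n + 1) => P) {x | x j ∈ A ∧ ∀ i, i ≠ j → (x i, x j) ∈ R i}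
      = ∫⁻ y in A, ∏ i, (if i = j then 1 else P {z | (z, y) ∈ R i}) ∂P := by
  have hmp := measurePreserving_piFinSuccAbove (fun _ : Fin (n + 1) => P) j
  let W : Set (Ω × (Fin n → Ω)) := {p | p.1 ∈ A ∧ ∀ l, (p.2 l, p.1) ∈ R (j.succAbove l)}
  have hW : MeasurableSet W := by
    refine (measurable_fst hA).inter
      (?_ : MeasurableSet {p : Ω × (Fin n → Ω) | ∀ l, (p.2 l, p.1) ∈ R (j.succAbove l)})
    rw [show {p : Ω × (Fin n → Ω) | ∀ l, (p.2 l, p.1) ∈ R (j.succAbove l)}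
      = ⋂ l, {p | (p.2 l, p.1) ∈ R (j.succAbove l)} by ext; simp]
    refine MeasurableSet.iInter fun l => ?_
    have : Measurable fun p : Ω × (Fin n → Ω) => (p.2 l, p.1) := by fun_prop
    exact this (hR _)
  have hpre : {x : Fin (n + 1) → Ω | x j ∈ A ∧ ∀ i, i ≠ j → (x i, x j) ∈ R i}
      = MeasurableEquiv.piFinSuccAbove (fun _ => Ω) j ⁻¹' W := by
    ext x
    simp only [Set.mem_preimage, W, Set.mem_ofPred_eq]
    refine and_congr Iff.rfl ⟨fun h l => h _ (Fin.succAbove_ne j l), fun h i hi => ?_⟩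
    obtain ⟨l, rfl⟩ := Fin.exists_succAbove_eq hi
    exact h l
  rw [hpre, hmp.measure_preimage hW.nullMeasurableSet, Measure.prod_apply hW,
    ← lintegral_indicator hA]
  congr 1 with y
  by_cases hy : y ∈ A
  · rw [Set.indicator_of_mem hy, Fin.prod_univ_succAbove _ j, if_pos rfl, one_mul]
    have : Prod.mk y ⁻¹' W = Set.univ.pi fun l => {z | (z, y) ∈ R (j.succAbove l)} := by
      ext w
      simp [W, hy]
    rw [this, Measure.pi_pi]
    refine Finset.prod_congr rfl fun l _ => ?_
    rw [if_neg (Fin.succAbove_ne j l)]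
  · rw [Set.indicator_of_notMem hy]
    have : Prod.mk y ⁻¹' W = ∅ := by
      ext w
      simp [W, hy]
    rw [this, measure_empty]

/-! ### The law of the output -/

/-- The event that among the first `n + 1` proposals number `j` lies in `A` and beats the others. -/
def winSet {Ω : Type*} (r : Ω → ℝ≥0∞) (A : Set Ω) {n : ℕ} (j : Fin (n + 1)) :
    Set ((ℕ → ℝ) × (Fin (n + 1) → Ω)) :=
  {p | p.2 j ∈ A ∧ ∀ i, i ≠ j →
    r (p.2 i) < ENNReal.ofReal (Real.exp (-p.1 i) / Real.exp (-p.1 j)) * r (p.2 j)}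

lemma measurableSet_winSet {Ω : Type*} [MeasurableSpace Ω] {r : Ω → ℝ≥0∞} (hr : Measurable r)
    {A : Set Ω} (hA : MeasurableSet A) {n : ℕ} (j : Fin (n + 1)) :
    MeasurableSet (winSet r A j) := by
  have hx : ∀ i, Measurable fun p : (ℕ → ℝ) × (Fin (n + 1) → Ω) => p.2 i := fun i => by fun_prop
  have h : winSet r A j = {p | p.2 j ∈ A} ∩ ⋂ i, ⋂ _ : i ≠ j, {p |
      r (p.2 i) < ENNReal.ofReal (Real.exp (-p.1 i) / Real.exp (-p.1 j)) * r (p.2 j)} := by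
    ext p
    simp [winSet]
  rw [h]
  refine (hx j hA).inter (MeasurableSet.iInter fun i => MeasurableSet.iInter fun _ => ?_)
  exact measurableSet_lt (hr.comp (hx i)) (Measurable.mul (by fun_prop) (hr.comp (hx j)))

lemma score_lt_of_mem_winSet {Ω : Type*} {r : Ω → ℝ≥0∞} {A : Set Ω} (h0 : ∀ x ∈ A, r x ≠ 0)
    (htop : ∀ x ∈ A, r x ≠ ∞) {n : ℕ} (j : Fin (n + 1)) {p : (ℕ → ℝ) × (Fin (n + 1) → Ω)}
    (hp : p ∈ winSet r A j) (i : Fin (n + 1)) (hi : i ≠ j) :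
    score r (p.2 i) (p.1 i) < score r (p.2 j) (p.1 j) :=
  score_lt_score (h0 _ hp.1) (htop _ hp.1) (hp.2 i hi)

lemma depthLimitedAStar_Y_mem {Ω : Type*} {r : Ω → ℝ≥0∞} {A : Set Ω} (h0 : ∀ x ∈ A, r x ≠ 0)
    (htop : ∀ x ∈ A, r x ≠ ∞) {n : ℕ} (j : Fin (n + 1)) {x : ℕ → Ω} {g : ℕ → ℝ}
    (hp : (g, fun i : Fin (n + 1) => x i) ∈ winSet r A j) :
    (depthLimitedAStar r x g (n + 1)).Y ∈ Sum.inl '' A := by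
  refine ⟨x j, hp.1, ?_⟩
  rw [depthLimitedAStar_Y_of_score_lt r x g j.2 (bot_lt_score (h0 _ hp.1) _)]
  intro i hi hij
  exact score_lt_of_mem_winSet h0 htop j hp ⟨i, hi⟩ (fun h => hij (congrArg Fin.val h))

/-- The chance that proposal `i` loses against the value `x` of proposal `j`. -/
def loseProb {Ω : Type*} [MeasurableSpace Ω] (P : Measure Ω) (r : Ω → ℝ≥0∞) (g : ℕ → ℝ) (x : Ω)
    (i j : ℕ) : ℝ≥0∞ :=
  if i = j then 1 else P {z | r z < ENNReal.ofReal (Real.exp (-g i) / Real.exp (-g j)) * r x}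

lemma measurable_loseProb {Ω : Type*} [MeasurableSpace Ω] (P : Measure Ω) [IsProbabilityMeasure P]
    {r : Ω → ℝ≥0∞} (hr : Measurable r) (i j : ℕ) {α : Type*} [MeasurableSpace α] {a : α → ℕ → ℝ}
    {b : α → Ω} (ha : Measurable a) (hb : Measurable b) :
    Measurable fun q => loseProb P r (a q) (b q) i j := by
  by_cases h : i = j
  · simp only [loseProb, h, if_true]; exact measurable_const
  · simp only [loseProb, h, if_false]
    have hs : MeasurableSet {q : α × Ω |
        r q.2 < ENNReal.ofReal (Real.exp (-a q.1 i) / Real.exp (-a q.1 j)) * r (b q.1)} :=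
      measurableSet_lt (by fun_prop) (by fun_prop)
    exact measurable_measure_prodMk_left hs

lemma measurable_prod_loseProb {Ω : Type*} [MeasurableSpace Ω] (P : Measure Ω)
    [IsProbabilityMeasure P] {r : Ω → ℝ≥0∞} (hr : Measurable r) (s : Finset ℕ) (j : ℕ) {α : Type*}
    [MeasurableSpace α] {a : α → ℕ → ℝ} {b : α → Ω} (ha : Measurable a) (hb : Measurable b) :
    Measurable fun q => ∏ i ∈ s, loseProb P r (a q) (b q) i j := by
  refine Finset.measurable_prod _ fun i _ => ?_
  exact measurable_loseProb P hr i j ha hb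

lemma gumbelChain_prod_pi_winSet {Ω : Type*} [MeasurableSpace Ω] (P : Measure Ω)
    [IsProbabilityMeasure P] {r : Ω → ℝ≥0∞} (hr : Measurable r)
    {A : Set Ω} (hA : MeasurableSet A) {n : ℕ} (j : Fin (n + 1)) :
    gumbelChain.prod (Measure.pi fun _ => P) (winSet r A j)
      = ∫⁻ g, ∫⁻ x in A, ∏ i ∈ Finset.range (n + 1), loseProb P r g x i j ∂P ∂gumbelChain := by
  rw [Measure.prod_apply (measurableSet_winSet hr hA j)]
  refine lintegral_congr fun g => ?_
  have := pi_setOf_forall_ne P j hA (R := fun i => {q : Ω × Ω |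
    r q.1 < ENNReal.ofReal (Real.exp (-g i) / Real.exp (-g j)) * r q.2})
    (fun i => measurableSet_lt (by fun_prop) (by fun_prop))
  refine Eq.trans this ?_
  refine lintegral_congr fun x => ?_
  rw [Finset.prod_range]
  refine Finset.prod_congr rfl fun i _ => ?_
  simp only [loseProb, Fin.val_inj, Set.mem_ofPred_eq]

/-- At most one proposal can strictly beat all others, so the winning events are disjoint and their
probabilities add. -/
lemma setLIntegral_gumbelChain_eq_prod_iUnion_winSet {Ω : Type*} [MeasurableSpace Ω] {P : Measure Ω}
    [IsProbabilityMeasure P] {r : Ω → ℝ≥0∞} (hr : Measurable r)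
    {A : Set Ω} (hA : MeasurableSet A) (h0 : ∀ x ∈ A, r x ≠ 0) (htop : ∀ x ∈ A, r x ≠ ∞) (n : ℕ) :
    ∫⁻ x in A, ∫⁻ g, ∑ j ∈ Finset.range (n + 1), ∏ i ∈ Finset.range (n + 1),
        loseProb P r g x i j ∂gumbelChain ∂P
      = gumbelChain.prod (Measure.pi fun _ => P)
          (⋃ j ∈ (Finset.univ : Finset (Fin (n + 1))), winSet r A j) := by
  have hs : Measurable fun q : Ω × (ℕ → ℝ) => ∑ j ∈ Finset.range (n + 1),
      ∏ i ∈ Finset.range (n + 1), loseProb P r q.2 q.1 i j := by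
    refine Finset.measurable_sum _ fun j _ => ?_
    exact measurable_prod_loseProb P hr _ j measurable_snd measurable_fst
  rw [measure_biUnion_finset _ fun j _ => measurableSet_winSet hr hA j]
  · simp_rw [gumbelChain_prod_pi_winSet P hr hA]
    rw [lintegral_lintegral_swap hs.aemeasurable, ← lintegral_finsetSum]
    · refine lintegral_congr fun g => ?_
      rw [lintegral_finsetSum (Finset.range (n + 1))
        (f := fun j x => ∏ i ∈ Finset.range (n + 1), loseProb P r g x i j), Finset.sum_range]
      intro j _
      exact measurable_prod_loseProb P hr _ j measurable_const measurable_id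
    · intro j _
      have h : Measurable fun q : (ℕ → ℝ) × Ω => ∏ i ∈ Finset.range (n + 1),
          loseProb P r q.1 q.2 i j :=
        measurable_prod_loseProb P hr _ j measurable_fst measurable_snd
      exact h.lintegral_prod_right' (ν := P.restrict A)
  · intro i _ j _ hij
    rw [Function.onFun, Set.disjoint_left]
    intro p hi hj
    exact lt_asymm (score_lt_of_mem_winSet h0 htop i hi j hij.symm) (score_lt_of_mem_winSet h0 htop j hj i hij)

lemma map_prodMk_eq_gumbelChain_prod_pi {Ω : Type*} [MeasurableSpace Ω] {P : Measure Ω}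
    [IsProbabilityMeasure P] {S : Type*} [MeasurableSpace S] {μ : Measure S} [IsProbabilityMeasure μ]
    {X : ℕ → S → Ω} (hXlaw : ∀ i, HasLaw (X i) P μ) (hXindep : iIndepFun X μ)
    {G : ℕ → S → ℝ} (hG : HasLaw (fun s i => G i s) gumbelChain μ)
    (hXG : IndepFun (fun s i => X i s) (fun s i => G i s) μ) (n : ℕ) :
    μ.map (fun s => (fun i => G i s, fun i : Fin n => X i s))
      = gumbelChain.prod (Measure.pi fun _ => P) := by
  have hXm : ∀ i, AEMeasurable (X i) μ := fun i => (hXlaw i).aemeasurable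
  have hpi : μ.map (fun s (i : Fin n) => X i s) = Measure.pi fun _ => P := by
    have h := (iIndepFun_iff_map_fun_eq_pi_map (f := fun i : Fin n => X i)
      (fun i => hXm i)).1 (hXindep.precomp Fin.val_injective)
    rw [h]
    congr 1 with i : 1
    exact (hXlaw i).map_eq
  have hind : IndepFun (fun s i => G i s) (fun s (i : Fin n) => X i s) μ :=
    (hXG.comp (φ := fun (x : ℕ → Ω) (i : Fin n) => x i) (ψ := id) (by fun_prop)
      measurable_id).symm
  have hXm' : AEMeasurable (fun s (i : Fin n) => X i s) μ := aemeasurable_pi_lambda _ fun i => hXm i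
  rw [← hG.map_eq, ← hpi]
  exact (indepFun_iff_map_prod_eq_prod_map_map hG.aemeasurable hXm').1 hind

lemma setLIntegral_le_measure_depthLimitedAStar {Ω : Type*} [MeasurableSpace Ω] {P : Measure Ω}
    [IsProbabilityMeasure P] {r : Ω → ℝ≥0∞} (hr : Measurable r)
    {S : Type*} [MeasurableSpace S] {μ : Measure S} [IsProbabilityMeasure μ]
    {X : ℕ → S → Ω} (hXlaw : ∀ i, HasLaw (X i) P μ) (hXindep : iIndepFun X μ)
    {G : ℕ → S → ℝ} (hG : HasLaw (fun s i => G i s) gumbelChain μ)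
    (hXG : IndepFun (fun s i => X i s) (fun s i => G i s) μ)
    {A : Set Ω} (hA : MeasurableSet A) (h0 : ∀ x ∈ A, r x ≠ 0) (htop : ∀ x ∈ A, r x ≠ ∞) (n : ℕ) :
    ∫⁻ x in A, ∫⁻ g, ∑ j ∈ Finset.range (n + 1), ∏ i ∈ Finset.range (n + 1),
        loseProb P r g x i j ∂gumbelChain ∂P
      ≤ μ {s | (depthLimitedAStar r (fun i => X i s) (fun i => G i s) (n + 1)).Y
          ∈ Sum.inl '' A} := by
  let Z : S → (ℕ → ℝ) × (Fin (n + 1) → Ω) := fun s => (fun i => G i s, fun i => X i s)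
  have hZm : AEMeasurable Z μ :=
    hG.aemeasurable.prodMk (aemeasurable_pi_lambda _ fun i => (hXlaw i).aemeasurable)
  have hZ : μ.map Z = gumbelChain.prod (Measure.pi fun _ => P) :=
    map_prodMk_eq_gumbelChain_prod_pi hXlaw hXindep hG hXG (n + 1)
  rw [setLIntegral_gumbelChain_eq_prod_iUnion_winSet hr hA h0 htop n, ← hZ,
    Measure.map_apply_of_aemeasurable hZm
      (Finset.measurableSet_biUnion _ fun j _ => measurableSet_winSet hr hA j)]
  refine measure_mono fun s hs => ?_
  simp only [Set.mem_preimage, Set.mem_iUnion] at hs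
  obtain ⟨j, -, hj⟩ := hs
  exact depthLimitedAStar_Y_mem h0 htop j hj

/-! ### The defect and the Kullback-Leibler divergence -/

/-- Everything passes through ln(1+Y). The remainder (1/Y - 1)/2 is chosen because its Q-mean is at
most 0 when Y = dQ/dP. -/
lemma defect_pow_mul_log_le {Y : ℝ} (hY : 0 < Y) {k : ℕ} (hk : k ≠ 0) :
    (1 - min 1 Y / Y) ^ k * Real.log (k + 1) ≤ Real.log Y + Real.log 2 + (Y⁻¹ - 1) / 2 := by
  have hlogk : 0 ≤ Real.log (k + 1) := Real.log_nonneg (by linarith [k.cast_nonneg (α := ℝ)])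
  -- Factor 1 + Y = 2Y · (1 + 1/Y)/2 and use ln z ≤ z - 1 on the last factor.
  have hend : Real.log (1 + Y) ≤ Real.log Y + Real.log 2 + (Y⁻¹ - 1) / 2 := by
    have h1 : 1 + Y = Y * 2 * ((1 + Y⁻¹) / 2) := by field_simp; ring
    have h2 := Real.log_le_sub_one_of_pos (show 0 < (1 + Y⁻¹) / 2 by positivity)
    rw [h1, Real.log_mul (by positivity) (by positivity), Real.log_mul (by positivity) (by norm_num)]
    linarith
  refine le_trans ?_ hend
  rcases le_or_gt Y 1 with h | h
  · rw [min_eq_right h, div_self hY.ne', sub_self, zero_pow hk, zero_mul]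
    exact Real.log_nonneg (by linarith)
  rw [min_eq_left h.le]
  have hinv : 1 / Y ≤ 1 := (div_le_one hY).2 h.le
  have hδ0 : 0 ≤ 1 - 1 / Y := by linarith
  rcases le_or_gt (k : ℝ) Y with hkY | hkY
  · calc (1 - 1 / Y) ^ k * Real.log (k + 1) ≤ 1 * Real.log (k + 1) := by
          gcongr
          exact pow_le_one₀ hδ0 (by linarith [one_div_pos.2 hY])
      _ ≤ Real.log (1 + Y) := by
          rw [one_mul]
          exact Real.log_le_log (by positivity) (by linarith)
  · have ha : 1 ≤ k / Y := (one_le_div hY).2 hkY.le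
    have h1 : (1 - 1 / Y) ^ k ≤ Real.exp (-(k / Y)) := by
      calc (1 - 1 / Y) ^ k ≤ Real.exp (-(1 / Y)) ^ k := by
            gcongr
            linarith [Real.add_one_le_exp (-(1 / Y))]
        _ = Real.exp (-(k / Y)) := by rw [← Real.exp_nat_mul]; congr 1; ring
    -- Bernoulli with exponent a = k/Y ≥ 1: 1 + k ≤ (1 + Y)^a. The factor a is then absorbed by a
    -- e^{-a} ≤ 1.
    have h2 : Real.log (k + 1) ≤ k / Y * Real.log (1 + Y) := by
      rw [← Real.log_rpow (by positivity)]
      refine Real.log_le_log (by positivity) ?_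
      have := one_add_mul_self_le_rpow_one_add (show -1 ≤ Y by linarith) ha
      rw [div_mul_cancel₀ _ hY.ne'] at this
      linarith
    have hlog : 0 ≤ Real.log (1 + Y) := Real.log_nonneg (by linarith)
    calc (1 - 1 / Y) ^ k * Real.log (k + 1)
        ≤ Real.exp (-(k / Y)) * (k / Y * Real.log (1 + Y)) := by gcongr
      _ = (Real.exp (-(k / Y)) * (k / Y)) * Real.log (1 + Y) := by ring
      _ ≤ 1 * Real.log (1 + Y) := by
          gcongr
          rw [Real.exp_neg, inv_mul_le_iff₀ (Real.exp_pos _), mul_one]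
          linarith [Real.add_one_le_exp (k / Y)]
      _ = _ := one_mul _

/-- The chance that a sample with density ratio `Y` is missed by a run with budget `k`. -/
noncomputable def defect {Ω : Type*} [MeasurableSpace Ω] (Q P : Measure Ω) (k : ℕ) (x : Ω) : ℝ :=
  (1 - min 1 (Q.rnDeriv P x).toReal / (Q.rnDeriv P x).toReal) ^ k

lemma defect_mem_Icc {Ω : Type*} [MeasurableSpace Ω] (Q P : Measure Ω) (k : ℕ) (x : Ω) :
    defect Q P k x ∈ Set.Icc (0 : ℝ) 1 := by
  have hY : 0 ≤ (Q.rnDeriv P x).toReal := ENNReal.toReal_nonneg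
  have h1 : min 1 (Q.rnDeriv P x).toReal / (Q.rnDeriv P x).toReal ≤ 1 :=
    div_le_one_of_le₀ (min_le_right _ _) hY
  have h2 : 0 ≤ min 1 (Q.rnDeriv P x).toReal / (Q.rnDeriv P x).toReal :=
    div_nonneg (le_min zero_le_one hY) hY
  exact ⟨pow_nonneg (by linarith) _, pow_le_one₀ (by linarith) (by linarith)⟩

lemma measurable_defect {Ω : Type*} [MeasurableSpace Ω] (Q P : Measure Ω) (k : ℕ) :
    Measurable (defect Q P k) := by
  unfold defect
  have := Measure.measurable_rnDeriv Q P
  fun_prop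

lemma integrable_defect {Ω : Type*} [MeasurableSpace Ω] (Q P : Measure Ω) [IsProbabilityMeasure Q]
    (k : ℕ) : Integrable (defect Q P k) Q := by
  refine Integrable.of_bound (measurable_defect Q P k).aestronglyMeasurable 1 (ae_of_all _ fun x => ?_)
  have := defect_mem_Icc Q P k x
  rw [Real.norm_of_nonneg this.1]
  exact this.2

lemma lintegral_rnDeriv_inv_le {Ω : Type*} [MeasurableSpace Ω] {P Q : Measure Ω}
    [IsProbabilityMeasure P] [IsProbabilityMeasure Q] (hQP : Q ≪ P) :
    ∫⁻ x, (Q.rnDeriv P x)⁻¹ ∂Q ≤ 1 := by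
  have hm := Measure.measurable_rnDeriv Q P
  calc ∫⁻ x, (Q.rnDeriv P x)⁻¹ ∂Q = ∫⁻ x, Q.rnDeriv P x * (Q.rnDeriv P x)⁻¹ ∂P :=
        (lintegral_rnDeriv_mul hQP hm.inv.aemeasurable).symm
    _ ≤ ∫⁻ _, 1 ∂P := lintegral_mono fun x => ENNReal.mul_inv_le_one _
    _ = 1 := by simp

lemma integral_defect_mul_logb_le {Ω : Type*} [MeasurableSpace Ω] {P Q : Measure Ω}
    [IsProbabilityMeasure P] [IsProbabilityMeasure Q] (hQP : Q ≪ P)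
    (hKL : Integrable (logRatio Q P) Q) {k : ℕ} (hk : k ≠ 0) :
    (∫ x, defect Q P k x ∂Q) * Real.logb 2 (k + 1) ≤ klBits Q P + 1 := by
  have hm := Measure.measurable_rnDeriv Q P
  have hlt : ∀ᵐ x ∂Q, Q.rnDeriv P x < ∞ := hQP.ae_le (Measure.rnDeriv_lt_top Q P)
  have hpos : ∀ᵐ x ∂Q, 0 < Q.rnDeriv P x := Measure.rnDeriv_pos hQP
  have hinvle := lintegral_rnDeriv_inv_le hQP
  have hinv : Integrable (fun x => ((Q.rnDeriv P x)⁻¹).toReal) Q :=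
    integrable_toReal_of_lintegral_ne_top hm.inv.aemeasurable (ne_top_of_le_ne_top (by simp) hinvle)
  have hinv1 : ∫ x, ((Q.rnDeriv P x)⁻¹).toReal ∂Q ≤ 1 := by
    rw [integral_toReal (f := fun x => (Q.rnDeriv P x)⁻¹) hm.inv.aemeasurable]
    · exact ENNReal.toReal_le_of_le_ofReal zero_le_one (by simpa using hinvle)
    · filter_upwards [hpos] with x hx
      simpa using hx
  have hlog2 : 0 < Real.log 2 := Real.log_pos (by norm_num)
  have hle : ∫ x, defect Q P k x * Real.log (k + 1) ∂Q
      ≤ ∫ x, (logRatio Q P x * Real.log 2 + Real.log 2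
          + (((Q.rnDeriv P x)⁻¹).toReal - 1) / 2) ∂Q := by
    refine integral_mono_ae ((integrable_defect Q P k).mul_const _)
      (((hKL.mul_const _).add (integrable_const _)).add
        ((hinv.sub (integrable_const _)).div_const _)) ?_
    filter_upwards [hlt, hpos] with x h1 h2
    have := defect_pow_mul_log_le (ENNReal.toReal_pos h2.ne' h1.ne) hk
    rw [logRatio, Real.logb, div_mul_cancel₀ _ hlog2.ne', ENNReal.toReal_inv]
    exact this
  have i1 : Integrable (fun x => logRatio Q P x * Real.log 2) Q := hKL.mul_const _
  have i2 : Integrable (fun x => logRatio Q P x * Real.log 2 + Real.log 2) Q :=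
    i1.add (integrable_const _)
  have i3 : Integrable (fun x => (((Q.rnDeriv P x)⁻¹).toReal - 1) / 2) Q :=
    (hinv.sub (integrable_const _)).div_const _
  rw [integral_mul_const, integral_add i2 i3, integral_add i1 (integrable_const _),
    integral_mul_const, integral_div, integral_sub hinv (integrable_const _)] at hle
  simp only [integral_const, probReal_univ, smul_eq_mul, one_mul] at hle
  rw [Real.logb, ← mul_div_assoc, div_le_iff₀ hlog2, klBits]
  linarith

lemma integral_defect_le {Ω : Type*} [MeasurableSpace Ω] {P Q : Measure Ω}
    [IsProbabilityMeasure P] [IsProbabilityMeasure Q] (hQP : Q ≪ P)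
    (hKL : Integrable (logRatio Q P) Q) {ε : ℝ} (hε : 0 < ε) {k : ℕ}
    (hk : ⌊(2 : ℝ) ^ ((klBits Q P + (Real.exp 1)⁻¹ * Real.logb 2 (Real.exp 1) + 1) / ε)⌋₊ ≤ k) :
    k ≠ 0 ∧ ∫ x, defect Q P k x ∂Q ≤ ε := by
  -- Nonnegativity is read off from the defect inequality at k = 1, where log₂(k + 1) = 1.
  have hC0 : 0 ≤ klBits Q P + 1 := by
    refine le_trans ?_ (integral_defect_mul_logb_le hQP hKL one_ne_zero)
    refine mul_nonneg (integral_nonneg fun x => (defect_mem_Icc Q P 1 x).1)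
      (Real.logb_nonneg (by norm_num) (by norm_num))
  have he : 0 ≤ (Real.exp 1)⁻¹ * Real.logb 2 (Real.exp 1) :=
    mul_nonneg (by positivity) (Real.logb_nonneg (by norm_num) (Real.one_le_exp zero_le_one))
  set C := klBits Q P + (Real.exp 1)⁻¹ * Real.logb 2 (Real.exp 1) + 1 with hC
  have hk0 : k ≠ 0 := by
    rintro rfl
    have h1 : (2 : ℝ) ^ (C / ε) < 1 := Nat.floor_eq_zero.1 (Nat.le_zero.1 hk)
    have h2 : (1 : ℝ) ≤ 2 ^ (C / ε) :=
      Real.one_le_rpow (by norm_num) (div_nonneg (by linarith) hε.le)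
    linarith
  refine ⟨hk0, ?_⟩
  -- The floor loses less than 1, which is why the defect is compared with log(k + 1) and not log k.
  have hlt : (2 : ℝ) ^ (C / ε) < k + 1 :=
    (Nat.lt_floor_add_one _).trans_le (by exact_mod_cast Nat.succ_le_succ hk)
  have hlog : C / ε ≤ Real.logb 2 (k + 1) :=
    ((Real.lt_logb_iff_rpow_lt (by norm_num) (by positivity)).2 hlt).le
  have hpos : 0 < Real.logb 2 ((k : ℝ) + 1) :=
    Real.logb_pos (by norm_num) (by have : (0 : ℝ) < k := by positivity
                                    linarith)
  rw [div_le_iff₀ hε] at hlog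
  refine le_of_mul_le_mul_right ?_ hpos
  have := integral_defect_mul_logb_le hQP hKL hk0
  linarith

/-! ### From a one-sided bound to total variation -/

/-- For probability measures the bound for the complement of B is the reverse inequality for B. -/
lemma tvDist_le_of_forall_le_add {α : Type*} [MeasurableSpace α] {μ ν : Measure α}
    [IsProbabilityMeasure μ] [IsProbabilityMeasure ν] {ε : ℝ}
    (h : ∀ B, MeasurableSet B → ν.real B ≤ μ.real B + ε) : tvDist μ ν ≤ ε := by
  refine ciSup_le fun B => ?_
  have h1 := h B.1 B.2
  have h2 := h B.1ᶜ B.2.compl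
  rw [probReal_compl_eq_one_sub B.2, probReal_compl_eq_one_sub B.2] at h2
  exact abs_le.2 ⟨by linarith, by linarith⟩

lemma measure_le_measure_depthLimitedAStar_add {Ω : Type*} [MeasurableSpace Ω] {P Q : Measure Ω}
    [IsProbabilityMeasure P] [IsProbabilityMeasure Q] (hQP : Q ≪ P)
    {r : Ω → ℝ≥0∞} (hr : Measurable r) {c : ℝ≥0∞} (hc0 : c ≠ 0) (hctop : c ≠ ∞)
    (hrc : r =ᵐ[P] fun x => c * Q.rnDeriv P x)
    {S : Type*} [MeasurableSpace S] {μ : Measure S} [IsProbabilityMeasure μ]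
    {X : ℕ → S → Ω} (hXlaw : ∀ i, HasLaw (X i) P μ) (hXindep : iIndepFun X μ)
    {G : ℕ → S → ℝ} (hG : HasLaw (fun s i => G i s) gumbelChain μ)
    (hXG : IndepFun (fun s i => X i s) (fun s i => G i s) μ) (n : ℕ)
    {B : Set (Ω ⊕ Unit)} (hB : MeasurableSet B) :
    Q (Sum.inl ⁻¹' B) ≤
      μ {s | (depthLimitedAStar r (fun i => X i s) (fun i => G i s) (n + 1)).Y ∈ B}
        + ∫⁻ x, ENNReal.ofReal (defect Q P (n + 1) x) ∂Q := by
  have hρm : Measurable fun x => c⁻¹ * r x := hr.const_mul _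
  have hcinv : c⁻¹ ≠ 0 := ENNReal.inv_ne_zero.2 hctop
  have hcinv' : c⁻¹ ≠ ∞ := ENNReal.inv_ne_top.2 hc0
  have hρ : (fun x => c⁻¹ * r x) =ᵐ[P] Q.rnDeriv P := by
    filter_upwards [hrc] with x hx
    rw [hx, ← mul_assoc, ENNReal.inv_mul_cancel hc0 hctop, one_mul]
  have hρ1 : ∫⁻ x, c⁻¹ * r x ∂P ≤ 1 := by
    rw [lintegral_congr_ae hρ]
    exact (Measure.lintegral_rnDeriv_le).trans (by simp)
  have hdm := Measure.measurable_rnDeriv Q P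
  -- Discards a Q-null set so that, at every remaining point, the density ratio is positive, finite
  -- and exactly r/c.
  let A : Set Ω := Sum.inl ⁻¹' B ∩ {x | r x ≠ 0 ∧ r x ≠ ∞ ∧ c⁻¹ * r x = Q.rnDeriv P x}
  have hA : MeasurableSet A := by
    refine (measurable_inl hB).inter ?_
    have h1 : MeasurableSet {x | r x ≠ 0} := (measurableSet_eq_fun hr measurable_const).compl
    have h2 : MeasurableSet {x | r x ≠ ∞} := (measurableSet_eq_fun hr measurable_const).compl
    exact h1.inter (h2.inter (measurableSet_eq_fun hρm hdm))
  have hQA : Q (Sum.inl ⁻¹' B) = Q A := by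
    refine measure_congr ?_
    filter_upwards [hQP.ae_le hρ, hQP.ae_le (Measure.rnDeriv_lt_top Q P), Measure.rnDeriv_pos hQP]
      with x h1 h2 h3
    have h4 : r x ≠ 0 := fun h => by
      rw [h, mul_zero] at h1
      exact h3.ne h1
    have h5 : r x ≠ ∞ := fun h => by
      rw [h, ENNReal.mul_top hcinv] at h1
      exact h2.ne h1.symm
    exact propext ⟨fun h => ⟨h, h4, h5, h1⟩, fun h => h.1⟩
  have hd : Measurable fun x => ENNReal.ofReal (defect Q P (n + 1) x) :=
    (measurable_defect Q P _).ennreal_ofReal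
  have hd' : Measurable fun x => ENNReal.ofReal (1 - defect Q P (n + 1) x) :=
    (measurable_const.sub (measurable_defect Q P _)).ennreal_ofReal
  have hwin : ∀ x ∈ A, Q.rnDeriv P x * ENNReal.ofReal (1 - defect Q P (n + 1) x) ≤
      ∫⁻ g, ∑ j ∈ Finset.range (n + 1), ∏ i ∈ Finset.range (n + 1),
        loseProb P r g x i j ∂gumbelChain := by
    rintro x ⟨-, h0, htop, hx⟩
    have hx0 : Q.rnDeriv P x ≠ 0 := hx ▸ mul_ne_zero hcinv h0
    have hxtop : Q.rnDeriv P x ≠ ∞ := hx ▸ ENNReal.mul_ne_top hcinv' htop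
    have h := le_lintegral_gumbelChain_sum_prod P hρm hρ1 (ENNReal.toReal_pos hx0 hxtop) n
    rw [ENNReal.ofReal_mul ENNReal.toReal_nonneg, ENNReal.ofReal_toReal hxtop] at h
    refine h.trans (le_of_eq (lintegral_congr fun g => ?_))
    refine Finset.sum_congr rfl fun j _ => Finset.prod_congr rfl fun i _ => ?_
    rw [loseProb]
    congr 2
    ext z
    -- Both sides of the comparison carry the factor c⁻¹, which is positive and finite and cancels.
    rw [Set.mem_ofPred_eq, Set.mem_ofPred_eq, ← hx, mul_left_comm,
      ENNReal.mul_lt_mul_iff_right hcinv hcinv']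
  calc Q (Sum.inl ⁻¹' B) = ∫⁻ x in A, 1 ∂Q := by rw [hQA, setLIntegral_one]
    _ = ∫⁻ x in A, (ENNReal.ofReal (1 - defect Q P (n + 1) x)
          + ENNReal.ofReal (defect Q P (n + 1) x)) ∂Q := by
        refine lintegral_congr fun x => ?_
        have := defect_mem_Icc Q P (n + 1) x
        rw [← ENNReal.ofReal_add (by linarith [this.2]) this.1]
        simp
    _ = ∫⁻ x in A, ENNReal.ofReal (1 - defect Q P (n + 1) x) ∂Q
          + ∫⁻ x in A, ENNReal.ofReal (defect Q P (n + 1) x) ∂Q := lintegral_add_right _ hd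
    _ ≤ _ := by
        refine add_le_add ?_ (setLIntegral_le_lintegral _ _)
        -- Passing from Q to P supplies the factor dQ/dP, turning 1 - δ^k into the bound Y (1 - δ^k)
        -- on the mean number of wins.
        rw [← setLIntegral_rnDeriv_mul hQP hd'.aemeasurable hA]
        refine (setLIntegral_mono' hA hwin).trans ?_
        refine (setLIntegral_le_measure_depthLimitedAStar hr hXlaw hXindep hG hXG hA
          (fun x hx => hx.2.1) (fun x hx => hx.2.2.1) n).trans (measure_mono fun s hs => ?_)
        obtain ⟨x, hx, hxY⟩ := hs
        have hxB : Sum.inl x ∈ B := hx.1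
        rwa [hxY] at hxB

end AStarCoding

open AStarCoding in
theorem mainTheorem2
    {Ω : Type*} [MeasurableSpace Ω] (P Q : Measure Ω)
    [IsProbabilityMeasure P] [IsProbabilityMeasure Q]
    (hQP : Q ≪ P) (hKL : Integrable (AStarCoding.logRatio Q P) Q)
    (r : Ω → ℝ≥0∞) (hr : Measurable r)
    (c : ℝ≥0∞) (hc0 : c ≠ 0) (hctop : c ≠ ∞)
    (hrc : r =ᵐ[P] fun x => c * Q.rnDeriv P x)
    {S : Type*} [MeasurableSpace S] (μ : Measure S) [IsProbabilityMeasure μ]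
    (X : ℕ → S → Ω) (hXlaw : ∀ i, HasLaw (X i) P μ) (hXindep : iIndepFun X μ)
    (G : ℕ → S → ℝ) (hG : HasLaw (fun s i => G i s) AStarCoding.gumbelChain μ)
    (hXG : IndepFun (fun s i => X i s) (fun s i => G i s) μ)
    (ε : ℝ) (hε : 0 < ε) (k : ℕ)
    (hk : ⌊(2 : ℝ) ^ ((AStarCoding.klBits Q P
        + (Real.exp 1)⁻¹ * Real.logb 2 (Real.exp 1) + 1) / ε)⌋₊ ≤ k) :
    (∀ s, (AStarCoding.depthLimitedAStar r (fun i => X i s) (fun i => G i s) k).N ≤ k) ∧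
    AStarCoding.tvDist
      (μ.map fun s => (AStarCoding.depthLimitedAStar r (fun i => X i s) (fun i => G i s) k).Y)
      (Q.map Sum.inl) ≤ ε := by
  refine ⟨fun s => depthLimitedAStar_N_le r _ _ k, ?_⟩
  obtain ⟨hk0, hdef⟩ := integral_defect_le hQP hKL hε hk
  obtain ⟨n, rfl⟩ := Nat.exists_eq_succ_of_ne_zero hk0
  have hXm : AEMeasurable (fun s i => X i s) μ :=
    aemeasurable_pi_lambda _ fun i => (hXlaw i).aemeasurable
  have hY : AEMeasurable
      (fun s => (depthLimitedAStar r (fun i => X i s) (fun i => G i s) (n + 1)).Y) μ :=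
    (measurable_depthLimitedAStar_Y hr (n + 1)).comp_aemeasurable (hXm.prodMk hG.aemeasurable)
  have := Measure.isProbabilityMeasure_map hY
  have := Measure.isProbabilityMeasure_map (μ := Q)
    (measurable_inl (α := Ω) (β := Unit)).aemeasurable
  refine tvDist_le_of_forall_le_add fun B hB => ?_
  have hle := measure_le_measure_depthLimitedAStar_add hQP hr hc0 hctop hrc hXlaw hXindep hG hXG n hB
  rw [← ofReal_integral_eq_lintegral_ofReal (integrable_defect Q P (n + 1))
    (ae_of_all _ fun x => (defect_mem_Icc Q P (n + 1) x).1)] at hle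
  have hle' := ENNReal.toReal_mono (by finiteness) hle
  rw [ENNReal.toReal_add (by finiteness) (by finiteness), ENNReal.toReal_ofReal
    (integral_nonneg fun x => (defect_mem_Icc Q P (n + 1) x).1)] at hle'
  rw [map_measureReal_apply measurable_inl hB, map_measureReal_apply_of_aemeasurable hY hB]
  exact hle'.trans (add_le_add_right hdef _)
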